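/- **Lemma 3.3.** Let $k\ge 1$ be a constant, let $\epsilon_c,\epsilon_s,\epsilon_z:\mathbb N\to[0,1]$, and let $L\in\mathsf{NP}$, with NP relation $\mathcal R_L$, have a $k$-round public-coin $(\epsilon_c,\epsilon_s,\epsilon_z)$-zero-knowledge proof or argument. Let $p$ be a polynomial with $p(n)>0$ for all large $n$. Then there are a probabilistic polynomial-time oracle-aided algorithm $R$ and families of oracle-aided functions $\mathcal F_1,\dots,\mathcal F_k$, where $\mathcal F_i=\{f_{i,x}\}_{x\in\{0,1\}^*}$ consists of functions on bit strings that use $k-i$ oracles and are polynomial-time computable given these oracles, such that for all probabilistic polynomial-time algorithms $\mathcal A_1,\dots,\mathcal A_k$ there is a negligible function $\nu$ such that for all large enough $n$: 1. for every $x\in L\cap\{0,1\}^n$, if for all $i\in\{1,\dots,k\}$ the algorithm $\mathcal A_i$ distributionally inverts $f_{i,x}^{\mathcal A_{i+1},\dots,\mathcal A_k}$ with deviation at most $1/p(n)$, then $$\Pr[R^{\mathcal A_1,\dots,\mathcal A_k}(x)=1]\ \ge\ 1-\epsilon_c(n)-k\,\epsilon_z(n)-\frac{3k-2}{p(n)}-\nu(n);$$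 2. for every $x\in\{0,1\}^n\setminus L$, $$\Pr[R^{\mathcal A_1,\dots,\mathcal A_k}(x)=1]\ \le\ \epsilon_s(n).$$ *Definitions.* In a $k$-round public-coin protocol, in each round $i$ the verifier sends a uniformly random string $r_i$ of prescribed, polynomial-time computable length, and the prover, who holds $x$ and possibly a witness $w$, answers with a string $\pi_i$; finally a deterministic polynomial-time $\mathsf V$ decides on $(x;r_1,\pi_1,\dots,r_k,\pi_k)$. It is an $(\epsilon_c,\epsilon_s,\epsilon_z)$-ZK *proof* for $L$ if, with $n=|x|$: (completeness) with the honest prover $\mathsf V$ accepts with probability at least $1-\epsilon_c(n)$ whenever $(x,w)\in\mathcal R_L$; (soundness) for $x\notin L$, $\mathsf V$ accepts with probability at most $\epsilon_s(n)$ whatever the prover does; (computational zero knowledge) there is a probabilistic polynomial-time $\mathsf{Sim}$ such that for each non-uniform probabilistic polynomial-time distinguisher and all large enough $n$, its advantage between $\mathsf{Sim}(x)$ and the honest transcript is at most $\epsilon_z(n)$ whenever $|x|=n$ and $(x,w)\in\mathcal R_L$. It is an *argument* if the honest prover runs in probabilistic polynomial time and soundness is required only against probabilistic polynomial-time provers,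 for each of them on all large enough $n$. A randomized oracle is treated as a deterministic gate that takes its random string as an additional input, and whose number of random bits is known to the caller. Let $N$ be $n=|x|$ plus the numbers of random bits of the available gates. Then $R$ runs in time polynomial in $N$ for all oracles, and each $f_{i,x}$ maps $\{0,1\}^{a_i(N)}$ to $\{0,1\}^{b_i(N)}$ for fixed polynomials $a_i,b_i$. "$\mathcal A$ distributionally inverts $f_x$ with deviation at most $\delta$" means that, for uniform $U$, the pairs $(U,f_x(U))$ and $(\mathcal A(x,f_x(U)),f_x(U))$, with fresh coins for $\mathcal A$, have statistical (total variation) distance at most $\delta$. -/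

import Mathlib

namespace CRZK

/-! ### Machine words

Programs work on finite binary trees.  Bit strings and lists of bit strings are stored as
right-nested lists, with `false` stored as `nil` and `true` as `cons nil nil`. -/

inductive Data : Type
  | nil : Data
  | cons (a b : Data) : Data

namespace Data

/-- Number of nodes of a tree, leaves included. -/
def size : Data → ℕ
  | nil => 1
  | cons a b => a.size + b.size + 1

def fst : Data → Data
  | nil => nil
  | cons a _ => a

def snd : Data → Data
  | nil => nil
  | cons _ b => b

/-- A tree read as an output bit: `nil` is `0`, everything else is `1`. -/
def truthy : Data → Bool
  | nil => false
  | cons _ _ => true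

def ofBool : Bool → Data
  | false => nil
  | true => cons nil nil

/-- Storage of a bit string; `toBits` is a left inverse. -/
def ofBits : List Bool → Data
  | [] => nil
  | b :: l => cons (ofBool b) (ofBits l)

def toBits : Data → List Bool
  | nil => []
  | cons a l => a.truthy :: l.toBits

/-- Storage of a list of bit strings (a transcript); `toMsgs` is a left inverse. -/
def ofMsgs : List (List Bool) → Data
  | [] => nil
  | m :: l => cons (ofBits m) (ofMsgs l)

def toMsgs : Data → List (List Bool)
  | nil => []
  | cons a l => a.toBits :: l.toMsgs

/-- The unary numeral `1ⁿ`. -/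
def unary (n : ℕ) : Data := ofBits (List.replicate n true)

open Classical in
/-- On a pair `(a, b)`: the bit `[a = b]`. -/
noncomputable def eqTest : Data → Data
  | nil => nil
  | cons a b => ofBool (decide (a = b))

end Data

/-! ### Oracle programs and their running time -/

/-- An oracle gate for a randomized algorithm: a deterministic function of the query and of an
explicit random string, together with the number of random bits that the gate expects. -/
structure Gate where
  coins : ℕ
  answer : Data → List Bool → List Bool

/-- While programs over `Data` with oracle gates indexed by `ι`.
`comp p q` runs first `p`, then `q`; `loop c b` repeats `b` as long as `c` returns `1`. -/
inductive Prog (ι : Type) : Type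
  | id : Prog ι
  | nil : Prog ι
  | fst : Prog ι
  | snd : Prog ι
  | eq : Prog ι
  | pair (p q : Prog ι) : Prog ι
  | comp (p q : Prog ι) : Prog ι
  | ite (c p q : Prog ι) : Prog ι
  | loop (c b : Prog ι) : Prog ι
  | coins (j : ι) : Prog ι
  | query (j : ι) : Prog ι

/-- `p.Runs O a b t`: with oracle gates `O`, the program `p` halts on `a` with output `b` in time
`t`.  Every elementary operation is charged at least the size of the tree that it produces, and the
operations that inspect their argument are charged the size of that argument, so that `t` agrees
with Turing machine time up to a polynomial.
* `coins j` returns the number of random bits of gate `j`, in unary.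
* `query j` on `(1^ℓ, q, ρ)` asks gate `j` the query `q` with random string `ρ` and reads the
  first `ℓ` bits of the answer; a long answer costs only as much as is read of it. -/
inductive Prog.Runs {ι : Type} (O : ι → Gate) : Prog ι → Data → Data → ℕ → Prop
  | id (a : Data) : Prog.Runs O .id a a a.size
  | nil (a : Data) : Prog.Runs O .nil a .nil 1
  | fst (a : Data) : Prog.Runs O .fst a a.fst a.size
  | snd (a : Data) : Prog.Runs O .snd a a.snd a.size
  | eq (a : Data) : Prog.Runs O .eq a a.eqTest a.size
  | pair {p q : Prog ι} {a b c : Data} {s t : ℕ} :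
      Prog.Runs O p a b s → Prog.Runs O q a c t → Prog.Runs O (.pair p q) a (.cons b c) (s + t + 1)
  | comp {p q : Prog ι} {a b c : Data} {s t : ℕ} :
      Prog.Runs O p a b s → Prog.Runs O q b c t → Prog.Runs O (.comp p q) a c (s + t + 1)
  | iteTrue {c p q : Prog ι} {a v b : Data} {s t : ℕ} :
      Prog.Runs O c a v s → v.truthy = true → Prog.Runs O p a b t →
        Prog.Runs O (.ite c p q) a b (s + t + 1)
  | iteFalse {c p q : Prog ι} {a v b : Data} {s t : ℕ} :
      Prog.Runs O c a v s → v.truthy = false → Prog.Runs O q a b t →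
        Prog.Runs O (.ite c p q) a b (s + t + 1)
  | loopStop {c p : Prog ι} {a v : Data} {s : ℕ} :
      Prog.Runs O c a v s → v.truthy = false → Prog.Runs O (.loop c p) a a (s + a.size + 1)
  | loopStep {c p : Prog ι} {a v b d : Data} {s t u : ℕ} :
      Prog.Runs O c a v s → v.truthy = true → Prog.Runs O p a b t →
        Prog.Runs O (.loop c p) b d u → Prog.Runs O (.loop c p) a d (s + t + u + 1)
  | coins (j : ι) (a : Data) :
      Prog.Runs O (.coins j) a (Data.unary (O j).coins) (a.size + (Data.unary (O j).coins).size)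
  | query (j : ι) (a : Data) :
      Prog.Runs O (.query j) a
        (Data.ofBits (((O j).answer a.snd.fst a.snd.snd.toBits).take a.fst.toBits.length))
        (a.size +
          (Data.ofBits
            (((O j).answer a.snd.fst a.snd.snd.toBits).take a.fst.toBits.length)).size)

open Classical in
/-- The output of `p` on `a` (programs are deterministic; `nil` if `p` does not halt). -/
noncomputable def Prog.eval {ι : Type} (O : ι → Gate) (p : Prog ι) (a : Data) : Data :=
  if h : ∃ b t, p.Runs O a b t then h.choose else .nil

/-- Total number of random bits expected by the gates. -/
def totalCoins {ι : Type} [Fintype ι] (O : ι → Gate) : ℕ := ∑ j, (O j).coins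

/-- Polynomial-time (oracle) programs: one polynomial bounds the running time for all oracle gates
and all inputs, in terms of the size of the input and of the random strings of the gates. -/
def Prog.PolyTime {ι : Type} [Fintype ι] (p : Prog ι) : Prop :=
  ∃ T : Polynomial ℕ, ∀ (O : ι → Gate) (a : Data),
    ∃ b t, p.Runs O a b t ∧ t ≤ T.eval (a.size + totalCoins O)

/-- The empty family of gates, for programs without oracles. -/
def noOracle : Empty → Gate := fun e => e.elim

/-! ### Probability -/

/-- The uniform distribution on bit strings of length `n`. -/
noncomputable def unif (n : ℕ) : PMF (List Bool) :=
  (PMF.uniformOfFintype (Fin n → Bool)).map List.ofFn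

/-- The probability that a sample of `X` satisfies `E`. -/
noncomputable def prob {α : Type} (X : PMF α) (E : α → Bool) : ℝ := ((X.map E) true).toReal

/-- Statistical distance. -/
noncomputable def statDist {α : Type} (X Y : PMF α) : ℝ :=
  (∑' a, |(X a).toReal - (Y a).toReal|) / 2

/-- Probabilistic polynomial-time oracle algorithms: a polynomial-time oracle program that gets
the pair of its input and a uniformly random string.  The length of that string is a polynomial in
the security parameter and the random bits of the gates. -/
structure RandAlg (ι : Type) [Fintype ι] where
  prog : Prog ι
  polyTime : prog.PolyTime
  coins : Polynomial ℕ

/-- Number of coins at security parameter `n`. -/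
def RandAlg.numCoins {ι : Type} [Fintype ι] (M : RandAlg ι) (O : ι → Gate) (n : ℕ) : ℕ :=
  M.coins.eval (n + totalCoins O)

/-- Output on input `a` with coins `ρ`. -/
noncomputable def RandAlg.run {ι : Type} [Fintype ι] (M : RandAlg ι) (O : ι → Gate) (a : Data)
    (ρ : List Bool) : Data :=
  M.prog.eval O (.cons a (.ofBits ρ))

/-- Output distribution at security parameter `n` on input `a`. -/
noncomputable def RandAlg.sample {ι : Type} [Fintype ι] (M : RandAlg ι) (O : ι → Gate) (n : ℕ)
    (a : Data) : PMF Data :=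
  (unif (M.numCoins O n)).map (M.run O a)

/-- Probabilistic polynomial-time algorithms (without oracles). -/
abbrev PPT : Type := RandAlg Empty

/-- A probabilistic polynomial-time algorithm as an oracle gate, at security parameter `n`. -/
noncomputable def PPT.gate (A : PPT) (n : ℕ) : Gate where
  coins := A.numCoins noOracle n
  answer q ρ := (A.run noOracle q ρ).toBits

/-! ### Languages and public-coin protocols -/

/-- `rel` is an NP relation of the language `L`. -/
def IsNPRelation (L : Language Bool) (rel : List Bool → List Bool → Prop) : Prop :=
  (∃ M : Prog Empty, M.PolyTime ∧
    ∀ x w, rel x w ↔ (M.eval noOracle (.cons (.ofBits x) (.ofBits w))).truthy = true) ∧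
  (∃ b : Polynomial ℕ, ∀ x w, rel x w → w.length ≤ b.eval x.length) ∧
  ∀ x, x ∈ L ↔ ∃ w, rel x w

/-- The verifier of a `k`-round public-coin protocol: in round `i < k` (counted from `0`) it sends
`coinLen i n` uniformly random bits, where `n` is the length of the instance; in the end it applies
a deterministic polynomial-time program to the instance and the transcript. -/
structure Verifier (k : ℕ) where
  prog : Prog Empty
  polyTime : prog.PolyTime
  coinLen : ℕ → ℕ → ℕ
  coinLen_polyTime : ∀ i < k, ∃ q : Prog Empty, q.PolyTime ∧
    ∀ n, q.eval noOracle (.unary n) = .unary (coinLen i n)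

/-- The decision of the verifier on the transcript `t = [r₁, π₁, …, r_k, π_k]`. -/
noncomputable def Verifier.accepts {k : ℕ} (V : Verifier k) (x : List Bool)
    (t : List (List Bool)) : Bool :=
  (V.prog.eval noOracle (.cons (.ofBits x) (.ofMsgs t))).truthy

/-- A prover strategy (for a fixed instance): given the messages `[r₁, π₁, …, rᵢ]` so far, the
distribution of the next message `πᵢ`. -/
abbrev Strategy : Type := List (List Bool) → PMF (List Bool)

/-- The transcript `[r₁, π₁, …, rᵢ, πᵢ]` of the first `i` rounds, with coin lengths `m`. -/
noncomputable def transcript (m : ℕ → ℕ) (P : Strategy) : ℕ → PMF (List (List Bool))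
  | 0 => PMF.pure []
  | i + 1 => (transcript m P i).bind fun t => (unif (m i)).bind fun r =>
      (P (t ++ [r])).map fun π => t ++ [r, π]

/-- The transcript of a whole execution on instance `x` with prover strategy `P`. -/
noncomputable def Verifier.view {k : ℕ} (V : Verifier k) (x : List Bool) (P : Strategy) :
    PMF (List (List Bool)) :=
  transcript (fun i => V.coinLen i x.length) P k

/-- Completeness error at most `ε`, for the honest view `view x w`. -/
def Complete {k : ℕ} (V : Verifier k) (rel : List Bool → List Bool → Prop)
    (view : List Bool → List Bool → PMF (List (List Bool))) (ε : ℕ → ℝ) : Prop :=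
  ∀ x w, rel x w → 1 - ε x.length ≤ prob (view x w) (V.accepts x)

/-- Probability that the distinguisher `D` with advice `z` outputs `1` on a sample of `X`. -/
noncomputable def distProb (D : PPT) (x z : List Bool) (X : PMF (List (List Bool))) : ℝ :=
  prob (X.bind fun t =>
    D.sample noOracle x.length (.cons (.ofBits x) (.cons (.ofBits z) (.ofMsgs t)))) Data.truthy

/-- Computational zero-knowledge with error `ε`: there is a probabilistic polynomial-time simulator
such that every non-uniform probabilistic polynomial-time distinguisher has advantage at most `ε`
on all sufficiently long instances with a witness. -/
def ZeroKnowledge (rel : List Bool → List Bool → Prop)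
    (view : List Bool → List Bool → PMF (List (List Bool))) (ε : ℕ → ℝ) : Prop :=
  ∃ Sim : PPT, ∀ (D : PPT) (z : ℕ → List Bool),
    (∃ b : Polynomial ℕ, ∀ n, (z n).length ≤ b.eval n) →
    ∃ N : ℕ, ∀ x w, N ≤ x.length → rel x w →
      |distProb D x (z x.length) ((Sim.sample noOracle x.length (.ofBits x)).map Data.toMsgs) -
        distProb D x (z x.length) (view x w)| ≤ ε x.length

/-- Soundness error at most `ε` against all provers. -/
def StatSound {k : ℕ} (V : Verifier k) (L : Language Bool) (ε : ℕ → ℝ) : Prop :=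
  ∀ x, x ∉ L → ∀ P : Strategy, prob (V.view x P) (V.accepts x) ≤ ε x.length

/-- Soundness error at most `ε` against every efficient prover (which uses fresh coins in each
round), on sufficiently long instances. -/
def CompSound {k : ℕ} (V : Verifier k) (L : Language Bool) (ε : ℕ → ℝ) : Prop :=
  ∀ P : PPT, ∃ N : ℕ, ∀ x, N ≤ x.length → x ∉ L →
    prob (V.view x fun t =>
      (P.sample noOracle x.length (.cons (.ofBits x) (.ofMsgs t))).map Data.toBits)
      (V.accepts x) ≤ ε x.length

/-- `L`, with NP relation `rel`, has a `k`-round public-coin `(εc, εs, εz)`-ZK proof. -/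
def HasZKProof (k : ℕ) (L : Language Bool) (rel : List Bool → List Bool → Prop)
    (εc εs εz : ℕ → ℝ) : Prop :=
  ∃ (V : Verifier k) (P : List Bool → List Bool → Strategy),
    Complete V rel (fun x w => V.view x (P x w)) εc ∧ StatSound V L εs ∧
    ZeroKnowledge rel (fun x w => V.view x (P x w)) εz

/-- The view of an execution with an efficient honest prover `P`, which holds a witness `w` and one
private random string for all rounds. -/
noncomputable def efficientView {k : ℕ} (V : Verifier k) (P : PPT) (x w : List Bool) :
    PMF (List (List Bool)) :=
  (unif (P.numCoins noOracle x.length)).bind fun ρ => V.view x fun t =>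
    PMF.pure (P.run noOracle (.cons (.ofBits x) (.cons (.ofBits w) (.ofMsgs t))) ρ).toBits

/-- `L`, with NP relation `rel`, has a `k`-round public-coin `(εc, εs, εz)`-ZK argument. -/
def HasZKArgument (k : ℕ) (L : Language Bool) (rel : List Bool → List Bool → Prop)
    (εc εs εz : ℕ → ℝ) : Prop :=
  ∃ (V : Verifier k) (P : PPT),
    Complete V rel (efficientView V P) εc ∧ CompSound V L εs ∧
    ZeroKnowledge rel (efficientView V P) εz

/-! ### Oracle-aided function families and distributional inversion -/

/-- A polynomial-time computable family of oracle-aided functions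
`f_x^O : {0,1}^(inLen N) → {0,1}^(outLen N)`, where `N` is the length of `x` plus the total number
of random bits of the gates in `O`. -/
structure FunFamily (ι : Type) [Fintype ι] where
  prog : Prog ι
  polyTime : prog.PolyTime
  inLen : Polynomial ℕ
  outLen : Polynomial ℕ
  length_eq : ∀ (O : ι → Gate) (x u : List Bool),
    u.length = inLen.eval (x.length + totalCoins O) →
    (prog.eval O (.cons (.ofBits x) (.ofBits u))).toBits.length =
      outLen.eval (x.length + totalCoins O)

/-- The value `f_x^O(u)`. -/
noncomputable def FunFamily.fn {ι : Type} [Fintype ι] (F : FunFamily ι) (O : ι → Gate)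
    (x u : List Bool) : List Bool :=
  (F.prog.eval O (.cons (.ofBits x) (.ofBits u))).toBits

/-- `A` distributionally inverts `f_x^O` with deviation at most `δ`: the distributions of
`(U, f_x^O(U))` and `(A(x, f_x^O(U)), f_x^O(U))` have statistical distance at most `δ`. -/
def DistInverts {ι : Type} [Fintype ι] (A : PPT) (F : FunFamily ι) (O : ι → Gate) (x : List Bool)
    (δ : ℝ) : Prop :=
  statDist
    ((unif (F.inLen.eval (x.length + totalCoins O))).map fun u => (u, F.fn O x u))
    ((unif (F.inLen.eval (x.length + totalCoins O))).bind fun u =>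
      (A.sample noOracle x.length (.cons (.ofBits x) (.ofBits (F.fn O x u)))).map fun d =>
        (d.toBits, F.fn O x u)) ≤ δ

end CRZK

open CRZK

namespace CRZK

/-! ### Basic facts about programs -/

/-! The reduction plays the protocol with itself: it tosses the verifier's coins and replaces the
prover by a strategy built from the inverters. The function of round `i` maps the simulator's coins
to a code of the simulated transcript up to the verifier's message of that round, together with a
bit: constantly 1 before the last round, and in the last round the verdict on the simulated
transcript. These functions ignore their oracles; only the input length depends on them. Let `P` be
a positive natural polynomial dominating `p`. Facing a transcript, the strategy asks for `P(n)`
preimages of it with bit 1 and reads the next prover message off each. For each message it estimates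
the acceptance probability by sampling the rest of the game, played recursively by the same
strategy, and it sends the message with the best estimate. Since `k` is constant, the recursion is
polynomial.

Soundness: the reduction is an execution of the honest verifier with some prover, and this prover is
efficient when the inverters are. So both kinds of soundness bound its acceptance probability
(`Scheme.ex_view_move`, `Scheme.exists_prover`).

Completeness is a hybrid argument. Let `H d` be the acceptance probability when the honest prover
plays until `d` rounds are left and the inverting prover plays these. Then `H 0` is honest
acceptance and `H k` is the reduction. The step from `H d` to `H (d + 1)` costs at most the expected
estimated advantage of the honest message over the chosen one, plus the overestimation of the chosen
one (`Scheme.ex_transcript_val_le`). The normalised advantage is an average over thresholds of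
efficiently decidable tests whose advice is the coins of the estimates and of the inverters. Zero
knowledge therefore moves it to the simulated transcript at the price of a single `εz`
(`Scheme.hybrid_step`).

On a simulated transcript, the simulator's seed is a perfectly distributed preimage of its image.
Replacing it by an inverter's answer costs `δ = 1/p(n)`; after that it competes with `P` independent
copies of itself and is strictly best with probability at most `1/(P+1)` (`ex_rank_le`). Using
`((P+1)P)²` samples, the total overestimation of the `P+1` candidates is at most `1/(2P)`
(`ex_countP_excess`). A round thus costs at most `εz + 3δ`. The last round costs only `εz + δ`:
there the estimates are exact, and the bit in the image makes every genuine preimage of an accepting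
image accepting. The sum is `k εz + (3k - 2) δ`, and no negligible term is needed. -/

theorem eval_mono (T : Polynomial ℕ) : Monotone fun n : ℕ => T.eval n := by
  intro a b h
  simp only [Polynomial.eval_eq_sum_range]
  gcongr

namespace Data

theorem one_le_size (a : Data) : 1 ≤ a.size := by
  cases a <;> simp [size]

theorem size_fst_le (a : Data) : a.fst.size ≤ a.size := by
  cases a <;> simp [size, fst]; omega

theorem size_snd_le (a : Data) : a.snd.size ≤ a.size := by
  cases a <;> simp [size, snd]; omega

theorem toBits_ofBits (l : List Bool) : (ofBits l).toBits = l := by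
  induction l with
  | nil => rfl
  | cons b l ih => cases b <;> simp [ofBits, toBits, ih, ofBool, truthy]

theorem toMsgs_ofMsgs (l : List (List Bool)) : (ofMsgs l).toMsgs = l := by
  induction l with
  | nil => rfl
  | cons b l ih => simp [ofMsgs, toMsgs, ih, toBits_ofBits]

theorem size_ofBits_le (l : List Bool) : (ofBits l).size ≤ 4 * l.length + 1 := by
  induction l with
  | nil => simp [ofBits, size]
  | cons b l ih => cases b <;> simp [ofBits, size, ofBool] <;> omega

theorem size_unary (n : ℕ) : (unary n).size = 4 * n + 1 := by
  induction n with
  | zero => simp [unary, ofBits, size]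
  | succ n ih =>
    simp only [unary, List.replicate_succ, ofBits, size, ofBool] at ih ⊢
    omega

theorem unary_succ (n : ℕ) : unary (n + 1) = cons (cons nil nil) (unary n) := by
  simp [unary, List.replicate_succ, ofBits, ofBool]

theorem length_toBits_unary (n : ℕ) : (unary n).toBits.length = n := by
  simp [unary, toBits_ofBits]

end Data

namespace Prog

variable {ι : Type} {O : ι → Gate}

/-- Every operation is charged at least the size of its output. Time bounds are therefore also
output size bounds, which makes polynomial time closed under composition. -/
theorem Runs.size_le {p : Prog ι} {a b : Data} {t : ℕ} (h : p.Runs O a b t) : b.size ≤ t := by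
  induction h with
  | id a => exact le_rfl
  | nil a => simp [Data.size]
  | fst a => exact a.size_fst_le
  | snd a => exact a.size_snd_le
  | eq a =>
    cases a with
    | nil => simp [Data.size, Data.eqTest]
    | cons a b =>
      have := a.one_le_size
      have := b.one_le_size
      simp only [Data.size, Data.eqTest]
      have h (c : Bool) : (Data.ofBool c).size ≤ 3 := by cases c <;> decide
      exact (h _).trans (by omega)
  | pair _ _ h1 h2 => simp only [Data.size]; omega
  | comp _ _ h1 h2 => omega
  | iteTrue _ _ _ h1 h2 => omega
  | iteFalse _ _ _ h1 h2 => omega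
  | loopStop _ _ h => omega
  | loopStep _ _ _ _ h1 h2 h3 => omega
  | coins j a => omega
  | query j a => omega

/-- `eval` picks some halting run, so uniqueness of the output is what lets any exhibited run
determine its value. -/
theorem Runs.det {p : Prog ι} {a b b' : Data} {t t' : ℕ} (h : p.Runs O a b t)
    (h' : p.Runs O a b' t') : b = b' := by
  induction h generalizing b' t' with
  | id a => cases h'; rfl
  | nil a => cases h'; rfl
  | fst a => cases h'; rfl
  | snd a => cases h'; rfl
  | eq a => cases h'; rfl
  | pair _ _ h1 h2 => cases h' with | pair g1 g2 => rw [h1 g1, h2 g2]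
  | comp _ _ h1 h2 =>
    cases h' with | comp g1 g2 => obtain rfl := h1 g1; exact h2 g2
  | iteTrue _ hv _ h1 h2 =>
    cases h' with
    | iteTrue g1 hv' g2 => exact h2 g2
    | iteFalse g1 hv' g2 => obtain rfl := h1 g1; simp [hv] at hv'
  | iteFalse _ hv _ h1 h2 =>
    cases h' with
    | iteFalse g1 hv' g2 => exact h2 g2
    | iteTrue g1 hv' g2 => obtain rfl := h1 g1; simp [hv] at hv'
  | loopStop _ hv h1 =>
    cases h' with
    | loopStop g1 hv' => rfl
    | loopStep g1 hv' g2 g3 => obtain rfl := h1 g1; simp [hv] at hv'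
  | loopStep _ hv _ _ h1 h2 h3 =>
    cases h' with
    | loopStop g1 hv' => obtain rfl := h1 g1; simp [hv] at hv'
    | loopStep g1 hv' g2 g3 => obtain rfl := h2 g2; exact h3 g3
  | coins j a => cases h'; rfl
  | query j a => cases h'; rfl

theorem Runs.eval_eq {p : Prog ι} {a b : Data} {t : ℕ} (h : p.Runs O a b t) :
    p.eval O a = b := by
  have hex : ∃ b t, p.Runs O a b t := ⟨b, t, h⟩
  rw [Prog.eval, dif_pos hex]
  exact hex.choose_spec.choose_spec.det h

/-- A program without oracles, seen as an oracle program. -/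
def lift : Prog Empty → Prog ι
  | .id => .id
  | .nil => .nil
  | .fst => .fst
  | .snd => .snd
  | .eq => .eq
  | .pair p q => .pair p.lift q.lift
  | .comp p q => .comp p.lift q.lift
  | .ite c p q => .ite c.lift p.lift q.lift
  | .loop c b => .loop c.lift b.lift
  | .coins j => j.elim
  | .query j => j.elim

theorem Runs.lift {p : Prog Empty} {O' : Empty → Gate} {a b : Data} {t : ℕ}
    (h : p.Runs O' a b t) : (p.lift : Prog ι).Runs O a b t := by
  induction h with
  | id a => exact .id a
  | nil a => exact .nil a
  | fst a => exact .fst a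
  | snd a => exact .snd a
  | eq a => exact .eq a
  | pair _ _ h1 h2 => exact .pair h1 h2
  | comp _ _ h1 h2 => exact .comp h1 h2
  | iteTrue _ hv _ h1 h2 => exact .iteTrue h1 hv h2
  | iteFalse _ hv _ h1 h2 => exact .iteFalse h1 hv h2
  | loopStop _ hv h => exact .loopStop h hv
  | loopStep _ hv _ _ h1 h2 h3 => exact .loopStep h1 hv h2 h3
  | coins j => exact j.elim
  | query j => exact j.elim

end Prog

/-! ### Encodings and polynomial-time functions -/

/-- A representation of the elements of a type as data. -/
class Enc (α : Type) where
  enc : α → Data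

open Enc

instance : Enc Data := ⟨fun d => d⟩
instance : Enc Bool := ⟨Data.ofBool⟩
instance : Enc ℕ := ⟨Data.unary⟩
instance {α β : Type} [Enc α] [Enc β] : Enc (α × β) := ⟨fun a => .cons (enc a.1) (enc a.2)⟩

/-- Representation of lists as right-nested pairs. -/
def encList {α : Type} [Enc α] : List α → Data
  | [] => .nil
  | a :: l => .cons (enc a) (encList l)

instance {α : Type} [Enc α] : Enc (List α) := ⟨encList⟩

section Enc

variable {α β : Type} [Enc α] [Enc β]

theorem enc_data (d : Data) : enc d = d := rfl

theorem enc_pair (a : α) (b : β) : enc (a, b) = .cons (enc a) (enc b) := rfl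

theorem enc_list_nil : enc ([] : List α) = .nil := rfl

theorem enc_list_cons (a : α) (l : List α) : enc (a :: l) = .cons (enc a) (enc l) := rfl

theorem enc_bits (l : List Bool) : enc l = Data.ofBits l := by
  induction l with
  | nil => rfl
  | cons b l ih => rw [enc_list_cons, ih]; rfl

theorem enc_msgs (l : List (List Bool)) : enc l = Data.ofMsgs l := by
  induction l with
  | nil => rfl
  | cons b l ih => rw [enc_list_cons, ih, enc_bits]; rfl

theorem enc_nat (n : ℕ) : enc n = Data.unary n := rfl

theorem enc_nat_replicate (n : ℕ) : enc n = enc (List.replicate n true) := by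
  rw [enc_bits]; rfl

theorem truthy_enc_bool (b : Bool) : (enc b).truthy = b := by cases b <;> rfl

theorem size_enc_bool_le (b : Bool) : (enc b).size ≤ 3 := by cases b <;> decide

theorem length_le_size (l : List α) : l.length ≤ (enc l).size := by
  induction l with
  | nil => simp
  | cons a l ih => simp only [enc_list_cons, Data.size, List.length_cons]; omega

theorem size_mem_le {a : α} {l : List α} (h : a ∈ l) : (enc a).size ≤ (enc l).size := by
  induction l with
  | nil => simp at h
  | cons b l ih =>
    simp only [enc_list_cons, Data.size]
    rcases List.mem_cons.1 h with rfl | h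
    · omega
    · have := ih h; omega

theorem size_enc_list_le (l : List α) (K : ℕ) (h : ∀ a ∈ l, (enc a).size ≤ K) :
    (enc l).size ≤ l.length * (K + 1) + 1 := by
  induction l with
  | nil => simp [enc_list_nil, Data.size]
  | cons b l ih =>
    have h1 := h b (by simp)
    have h2 := ih fun a ha => h a (by simp [ha])
    simp only [enc_list_cons, Data.size, List.length_cons]
    linarith [add_mul l.length 1 (K + 1)]

theorem size_append (l l' : List α) :
    (enc (l ++ l')).size + 1 = (enc l).size + (enc l').size := by
  induction l with
  | nil => simp [enc_list_nil, Data.size]; omega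
  | cons b l ih => simp only [List.cons_append, enc_list_cons, Data.size]; omega

end Enc

/-- Typed functions, relative to oracle gates, that are computed by a polynomial-time program. -/
def FP {ι α β : Type} [Fintype ι] [Enc α] [Enc β] (f : (ι → Gate) → α → β) : Prop :=
  ∃ (p : Prog ι) (T : Polynomial ℕ), ∀ O a,
    ∃ t, p.Runs O (enc a) (enc (f O a)) t ∧ t ≤ T.eval ((enc a).size + totalCoins O)

namespace FP

variable {ι α β γ σ : Type} [Fintype ι] [Enc α] [Enc β] [Enc γ] [Enc σ]

theorem size_bound {f : (ι → Gate) → α → β} (hf : FP f) :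
    ∃ T : Polynomial ℕ, ∀ O a, (enc (f O a)).size ≤ T.eval ((enc a).size + totalCoins O) := by
  obtain ⟨p, T, h⟩ := hf
  refine ⟨T, fun O a => ?_⟩
  obtain ⟨t, h1, h2⟩ := h O a
  exact h1.size_le.trans h2

/-- Functions computed in the same way as `f` up to encodings. -/
theorem recode {α' β' : Type} [Enc α'] [Enc β'] {f : (ι → Gate) → α → β}
    {g : (ι → Gate) → α' → β'} (hf : FP f)
    (h : ∀ O a', ∃ a, enc a = enc a' ∧ enc (f O a) = enc (g O a')) : FP g := by
  obtain ⟨p, T, hp⟩ := hf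
  refine ⟨p, T, fun O a' => ?_⟩
  obtain ⟨a, h1, h2⟩ := h O a'
  rw [← h1, ← h2]
  exact hp O a

theorem id : FP fun (_ : ι → Gate) (a : α) => a :=
  ⟨.id, .X, fun O a => ⟨_, .id _, by simp⟩⟩

theorem comp {g : (ι → Gate) → β → γ} {f : (ι → Gate) → α → β} (hg : FP g) (hf : FP f) :
    FP fun O a => g O (f O a) := by
  obtain ⟨p, T, hp⟩ := hf
  obtain ⟨q, T', hq⟩ := hg
  refine ⟨.comp p q, T + T'.comp (T + .X) + 1, fun O a => ?_⟩
  obtain ⟨s, h1, h2⟩ := hp O a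
  obtain ⟨t, h3, h4⟩ := hq O (f O a)
  refine ⟨_, .comp h1 h3, ?_⟩
  have h5 : T'.eval ((enc (f O a)).size + totalCoins O) ≤
      T'.eval (T.eval ((enc a).size + totalCoins O) + ((enc a).size + totalCoins O)) :=
    eval_mono T' (by have := h1.size_le; omega)
  simp only [Polynomial.eval_add, Polynomial.eval_comp, Polynomial.eval_X, Polynomial.eval_one]
  omega

theorem pair {f : (ι → Gate) → α → β} {g : (ι → Gate) → α → γ} (hf : FP f) (hg : FP g) :
    FP fun O a => (f O a, g O a) := by
  obtain ⟨p, T, hp⟩ := hf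
  obtain ⟨q, T', hq⟩ := hg
  refine ⟨.pair p q, T + T' + 1, fun O a => ?_⟩
  obtain ⟨s, h1, h2⟩ := hp O a
  obtain ⟨t, h3, h4⟩ := hq O a
  refine ⟨_, .pair h1 h3, ?_⟩
  simp only [Polynomial.eval_add, Polynomial.eval_one]
  omega

theorem prim {p : Prog ι} {f : (ι → Gate) → α → β} (c : ℕ)
    (h : ∀ O a, ∃ t, p.Runs O (enc a) (enc (f O a)) t ∧
      t ≤ c * ((enc a).size + totalCoins O)) : FP f :=
  ⟨p, .C c * .X, fun O a => by simpa using h O a⟩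

theorem fst {f : (ι → Gate) → α → β × γ} (hf : FP f) : FP fun O a => (f O a).1 :=
  comp (g := fun _ b => b.1) (prim (p := .fst) 1 fun O a => ⟨_, .fst _, by simp⟩) hf

theorem snd {f : (ι → Gate) → α → β × γ} (hf : FP f) : FP fun O a => (f O a).2 :=
  comp (g := fun _ b => b.2) (prim (p := .snd) 1 fun O a => ⟨_, .snd _, by simp⟩) hf

theorem dataFst {f : (ι → Gate) → α → Data} (hf : FP f) : FP fun O a => (f O a).fst :=
  comp (g := fun _ b => b.fst) (prim (p := .fst) 1 fun O a => ⟨_, .fst _, by simp⟩) hf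

theorem dataSnd {f : (ι → Gate) → α → Data} (hf : FP f) : FP fun O a => (f O a).snd :=
  comp (g := fun _ b => b.snd) (prim (p := .snd) 1 fun O a => ⟨_, .snd _, by simp⟩) hf

theorem nil : FP fun (_ : ι → Gate) (_ : α) => ([] : List β) :=
  prim (p := .nil) 1 fun O a => ⟨_, .nil _, by have := (enc a).one_le_size; omega⟩

theorem constData (d : Data) : FP fun (_ : ι → Gate) (_ : α) => d := by
  induction d with
  | nil => exact prim (p := .nil) 1 fun O a => ⟨_, .nil _, by have := (enc a).one_le_size; omega⟩
  | cons d e ih1 ih2 => exact (ih1.pair ih2).recode fun O a => ⟨a, rfl, rfl⟩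

theorem const (b : β) : FP fun (_ : ι → Gate) (_ : α) => b :=
  (constData (enc b)).recode fun _ a => ⟨a, rfl, rfl⟩

theorem cons {f : (ι → Gate) → α → β} {g : (ι → Gate) → α → List β} (hf : FP f) (hg : FP g) :
    FP fun O a => f O a :: g O a :=
  (hf.pair hg).recode fun _ a => ⟨a, rfl, rfl⟩

theorem ite {c : (ι → Gate) → α → Bool} {f g : (ι → Gate) → α → β} (hc : FP c) (hf : FP f)
    (hg : FP g) : FP fun O a => if c O a then f O a else g O a := by
  obtain ⟨r, T₀, hr⟩ := hc
  obtain ⟨p, T, hp⟩ := hf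
  obtain ⟨q, T', hq⟩ := hg
  refine ⟨.ite r p q, T₀ + T + T' + 1, fun O a => ?_⟩
  obtain ⟨u, h5, h6⟩ := hr O a
  obtain ⟨s, h1, h2⟩ := hp O a
  obtain ⟨t, h3, h4⟩ := hq O a
  simp only [Polynomial.eval_add, Polynomial.eval_one]
  cases h : c O a with
  | true =>
    rw [h] at h5
    exact ⟨_, .iteTrue h5 rfl h1, by omega⟩
  | false =>
    rw [h] at h5
    exact ⟨_, .iteFalse h5 rfl (by simpa using h3), by omega⟩

theorem truthy : FP fun (_ : ι → Gate) (d : Data) => d.truthy :=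
  prim (p := .ite .id (.pair .nil .nil) .nil) 5 fun O d => by
    have := d.one_le_size
    cases h : d.truthy with
    | true => exact ⟨_, .iteTrue (.id _) h (.pair (.nil _) (.nil _)), by simp [enc_data]; omega⟩
    | false => exact ⟨_, .iteFalse (.id _) h (.nil _), by simp [enc_data]; omega⟩

/-- The only use of `loop`; all other iterations are derived from it. A polynomial-time step may
still square its accumulator in each pass, so a bound on the accumulators over all prefixes has to
be supplied. The loop state is (remaining list, argument, accumulator), and the loop stops when the
first component is `nil`. -/
theorem foldl {f : (ι → Gate) → α → σ → β → σ} {l : (ι → Gate) → α → List β}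
    {s : (ι → Gate) → α → σ} (hf : FP fun O (a : α × σ × β) => f O a.1 a.2.1 a.2.2) (hl : FP l)
    (hs : FP s) (hB : ∃ B : Polynomial ℕ, ∀ O a l', l' <+: l O a →
      (enc (l'.foldl (f O a) (s O a))).size ≤ B.eval ((enc a).size + totalCoins O)) :
    FP fun O a => (l O a).foldl (f O a) (s O a) := by
  obtain ⟨B, hB⟩ := hB
  obtain ⟨pf, Tf, hpf⟩ := hf
  let body : Prog ι := .pair (.comp .fst .snd) (.pair (.comp .snd .fst)
    (.comp (.pair (.comp .snd .fst) (.pair (.comp .snd .snd) (.comp .fst .fst))) pf))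
  obtain ⟨pl, Tl, hpl⟩ := hl
  obtain ⟨ps, Ts, hps⟩ := hs
  -- `Z` bounds the remaining list, the argument and the accumulator together; `K` bounds the cost
  -- of one pass.
  let Z : Polynomial ℕ := Tl + .X + B + 2
  let K : Polynomial ℕ := 20 * Z + 20 + Tf.comp (Z + .X)
  refine ⟨.comp (.pair pl (.pair .id ps)) (.comp (.loop .fst body) (.comp .snd .snd)),
    Tl + Ts + .X + (Tl + 1) * K + 4 * Z + 10, fun O a => ?_⟩
  obtain ⟨tl, hl1, hl2⟩ := hpl O a
  obtain ⟨ts, hs1, hs2⟩ := hps O a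
  set n := (enc a).size + totalCoins O with hn
  have hZ : Z.eval n = Tl.eval n + n + B.eval n + 2 := by simp [Z]
  have hK : K.eval n = 20 * Z.eval n + 20 + Tf.eval (Z.eval n + n) := by
    simp [K, Polynomial.eval_comp]
  -- Loop invariant: `pre` is the part of the list already consumed and `r` the part still to come.
  have key : ∀ (r pre : List β), pre ++ r = l O a →
      ∃ t, (Prog.loop .fst body).Runs O
        (.cons (enc r) (.cons (enc a) (enc (pre.foldl (f O a) (s O a)))))
        (.cons .nil (.cons (enc a) (enc ((l O a).foldl (f O a) (s O a))))) t ∧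
        t ≤ (r.length + 1) * K.eval n := by
    intro r
    induction r with
    | nil =>
      intro pre h
      obtain rfl : pre = l O a := by simpa using h
      have h1 := hB O a _ (List.prefix_refl _)
      rw [← hn] at h1
      refine ⟨_, .loopStop (.fst _) rfl, ?_⟩
      simp only [enc_list_nil, Data.size, List.length_nil]
      omega
    | cons b r ih =>
      intro pre h
      obtain ⟨t, h1, h2⟩ := ih (pre ++ [b]) (by simpa using h)
      rw [List.foldl_append, List.foldl_cons, List.foldl_nil] at h1
      set st := pre.foldl (f O a) (s O a) with hst
      have hb1 := hB O a pre ⟨_, h⟩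
      rw [← hn, ← hst] at hb1
      have hb2 : (enc (b :: r)).size ≤ (enc (l O a)).size := by
        have := (enc pre).one_le_size
        have := size_append pre (b :: r)
        rw [h] at this
        omega
      have hb3 := hl1.size_le
      obtain ⟨t', h3, h4⟩ := hpf O (a, st, b)
      have h5 : Tf.eval ((enc (a, st, b)).size + totalCoins O) ≤ Tf.eval (Z.eval n + n) := by
        apply eval_mono
        simp only [enc_pair, enc_list_cons, Data.size] at hb2 ⊢
        omega
      refine ⟨_, .loopStep (.fst _) rfl (.pair (.comp (.fst _) (.snd _)) (.pair
        (.comp (.snd _) (.fst _)) (.comp (.pair (.comp (.snd _) (.fst _)) (.pair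
          (.comp (.snd _) (.snd _)) (.comp (.fst _) (.fst _)))) h3))) h1, ?_⟩
      simp only [Data.fst, Data.snd, enc_list_cons, Data.size, List.length_cons] at hb2 ⊢
      rw [add_mul (r.length + 1), one_mul]
      omega
  obtain ⟨t, h1, h2⟩ := key (l O a) [] rfl
  have hb1 := hB O a _ (List.prefix_refl _)
  rw [← hn] at hb1
  refine ⟨_, .comp (.pair hl1 (.pair (.id _) hs1)) (.comp h1 (.comp (.snd _) (.snd _))), ?_⟩
  have h3 : ((l O a).length + 1) * K.eval n ≤ (Tl.eval n + 1) * K.eval n :=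
    Nat.mul_le_mul_right _ (by
      have := length_le_size (l O a)
      have := hl1.size_le
      omega)
  simp only [Data.snd, Data.size, Polynomial.eval_add,
    Polynomial.eval_mul, Polynomial.eval_one, Polynomial.eval_X, Polynomial.eval_ofNat]
  omega

end FP
end CRZK

/-! ### Closure properties of polynomial-time functions -/

namespace CRZK
open Enc

theorem size_enc_nat (n : ℕ) : (enc n).size = 4 * n + 1 := Data.size_unary n

theorem size_prefix_le {α : Type} [Enc α] {l l' : List α} (h : l' <+: l) :
    (enc l').size ≤ (enc l).size := by
  obtain ⟨r, rfl⟩ := h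
  have := size_append l' r
  have := (enc r).one_le_size
  omega

theorem size_suffix_le {α : Type} [Enc α] {l l' : List α} (h : l' <:+ l) :
    (enc l').size ≤ (enc l).size := by
  obtain ⟨r, rfl⟩ := h
  have := size_append r l'
  have := (enc r).one_le_size
  omega

theorem size_reverse {α : Type} [Enc α] (l : List α) : (enc l.reverse).size = (enc l).size := by
  induction l with
  | nil => rfl
  | cons a l ih =>
    have := size_append l.reverse [a]
    simp only [List.reverse_cons, enc_list_cons, enc_list_nil, Data.size] at *
    omega

theorem size_flatMap_le {α β : Type} [Enc β] (f : α → List β) (l : List α) (K : ℕ)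
    (h : ∀ a ∈ l, (enc (f a)).size ≤ K) : (enc (l.flatMap f)).size ≤ l.length * K + 1 := by
  induction l with
  | nil => simp [enc_list_nil, Data.size]
  | cons a l ih =>
    have h1 := h a (by simp)
    have h2 := ih fun b hb => h b (by simp [hb])
    have h3 := size_append (f a) (l.flatMap f)
    rw [List.flatMap_cons, List.length_cons, add_mul, one_mul]
    omega

/-- Number-valued functions bounded by a polynomial in the size of the argument. -/
def PolyBdd {ι α : Type} [Fintype ι] [Enc α] (g : (ι → Gate) → α → ℕ) : Prop :=
  ∃ B : Polynomial ℕ, ∀ O a, g O a ≤ B.eval ((enc a).size + totalCoins O)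

namespace PolyBdd

variable {ι α : Type} [Fintype ι] [Enc α] {g h : (ι → Gate) → α → ℕ}

theorem mono (hh : PolyBdd h) (H : ∀ O a, g O a ≤ h O a) : PolyBdd g := by
  obtain ⟨B, hB⟩ := hh
  exact ⟨B, fun O a => (H O a).trans (hB O a)⟩

theorem const (n : ℕ) : PolyBdd fun (_ : ι → Gate) (_ : α) => n := ⟨.C n, by simp⟩

theorem add (hg : PolyBdd g) (hh : PolyBdd h) : PolyBdd fun O a => g O a + h O a := by
  obtain ⟨B, hB⟩ := hg
  obtain ⟨C, hC⟩ := hh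
  exact ⟨B + C, fun O a => by simpa using add_le_add (hB O a) (hC O a)⟩

theorem mul (hg : PolyBdd g) (hh : PolyBdd h) : PolyBdd fun O a => g O a * h O a := by
  obtain ⟨B, hB⟩ := hg
  obtain ⟨C, hC⟩ := hh
  exact ⟨B * C, fun O a => by simpa using mul_le_mul' (hB O a) (hC O a)⟩

theorem size {β : Type} [Enc β] {f : (ι → Gate) → α → β} (hf : FP f) :
    PolyBdd fun O a => (enc (f O a)).size := hf.size_bound

end PolyBdd

namespace FP

variable {ι α β γ σ : Type} [Fintype ι] [Enc α] [Enc β] [Enc γ] [Enc σ]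

theorem toData {f : (ι → Gate) → α → β} (hf : FP f) : FP fun O a => enc (f O a) :=
  hf.recode fun _ a => ⟨a, rfl, rfl⟩

theorem tail {f : (ι → Gate) → α → List β} (hf : FP f) : FP fun O a => (f O a).tail :=
  comp (g := fun _ b => b.tail) (prim (p := .snd) 1 fun O a => ⟨_, by
    have h : enc a.tail = (enc a).snd := by cases a <;> rfl
    rw [h]; exact .snd _, by simp⟩) hf

theorem headD {f : (ι → Gate) → α → List (List β)} (hf : FP f) :
    FP fun O a => (f O a).headD [] :=
  comp (g := fun _ b => b.headD []) (prim (p := .fst) 1 fun O a => ⟨_, by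
    have h : enc (a.headD []) = (enc a).fst := by cases a <;> rfl
    rw [h]; exact .fst _, by simp⟩) hf

theorem getD {f : (ι → Gate) → α → List (List β)} (hf : FP f) (j : ℕ) :
    FP fun O a => (f O a).getD j [] := by
  induction j generalizing f with
  | zero =>
    refine hf.headD.recode fun O a => ⟨a, rfl, ?_⟩
    cases f O a <;> rfl
  | succ j ih =>
    refine (ih hf.tail).recode fun O a => ⟨a, rfl, ?_⟩
    cases f O a <;> simp

theorem takeD {f : (ι → Gate) → α → List (List β)} (hf : FP f) (j : ℕ) :
    FP fun O a => (f O a).takeD j [] := by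
  induction j generalizing f with
  | zero => exact nil
  | succ j ih => exact cons hf.headD (ih hf.tail)

theorem foldl' {f : (ι → Gate) → α → σ → β → σ} {l : (ι → Gate) → α → List β}
    {s : (ι → Gate) → α → σ} {b : (ι → Gate) → α → ℕ}
    (hf : FP fun O (a : α × σ × β) => f O a.1 a.2.1 a.2.2) (hl : FP l)
    (hs : FP s) (hb : PolyBdd b) (hB : ∀ O a l', l' <+: l O a →
      (enc (l'.foldl (f O a) (s O a))).size ≤ b O a) :
    FP fun O a => (l O a).foldl (f O a) (s O a) := by
  obtain ⟨B, h⟩ := hb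
  exact foldl hf hl hs ⟨B, fun O a l' hl' => (hB O a l' hl').trans (h O a)⟩

theorem reverse {l : (ι → Gate) → α → List β} (hl : FP l) : FP fun O a => (l O a).reverse := by
  have h (l' s : List β) : l'.foldl (fun s b => b :: s) s = l'.reverse ++ s := by
    induction l' generalizing s with
    | nil => rfl
    | cons b l' ih => simp [ih]
  refine (foldl' (f := fun _ _ s b => b :: s) (s := fun _ _ => []) (cons id.snd.snd id.snd.fst) hl
    nil (PolyBdd.size hl) fun O a l' hl' => ?_).recode fun O a => ⟨a, rfl, by simp [h]⟩
  rw [h, List.append_nil, size_reverse]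
  exact size_prefix_le hl'

theorem append {l l' : (ι → Gate) → α → List β} (hl : FP l) (hl' : FP l') :
    FP fun O a => l O a ++ l' O a := by
  have h (l' s : List β) : l'.foldl (fun s b => b :: s) s = l'.reverse ++ s := by
    induction l' generalizing s with
    | nil => rfl
    | cons b l' ih => simp [ih]
  refine (foldl' (f := fun _ _ s b => b :: s) (cons id.snd.snd id.snd.fst) hl.reverse hl'
    ((PolyBdd.size hl).add (PolyBdd.size hl')) fun O a r hr => ?_).recode
    fun O a => ⟨a, rfl, by simp [h]⟩
  have h1 := size_append r.reverse (l' O a)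
  have h2 := size_prefix_le hr
  rw [size_reverse] at h1 h2
  rw [h]
  omega

theorem flatMap {f : (ι → Gate) → α → β → List γ} {l : (ι → Gate) → α → List β}
    (hf : FP fun O (a : α × β) => f O a.1 a.2) (hl : FP l) :
    FP fun O a => (l O a).flatMap (f O a) := by
  have h (g : β → List γ) (l' : List β) (s : List γ) :
      l'.foldl (fun s b => s ++ g b) s = s ++ l'.flatMap g := by
    induction l' generalizing s with
    | nil => simp
    | cons b l' ih => simp [ih]
  obtain ⟨B, hB⟩ := hf.size_bound
  refine (foldl' (f := fun O a s b => s ++ f O a b) (s := fun _ _ => [])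
    (b := fun O a => (enc (l O a)).size *
      B.eval ((enc a).size + (enc (l O a)).size + 1 + totalCoins O) + 1)
    (append id.snd.fst (hf.comp (id.fst.pair id.snd.snd))) hl nil ?_ ?_).recode
    fun O a => ⟨a, rfl, by simp [h]⟩
  · obtain ⟨C, hC⟩ := hl.size_bound
    refine ⟨C * B.comp (.X + C + 1) + 1, fun O a => ?_⟩
    simp only [Polynomial.eval_add, Polynomial.eval_mul, Polynomial.eval_comp, Polynomial.eval_X,
      Polynomial.eval_one]
    have h1 := hC O a
    gcongr
    exact eval_mono B (by omega)
  · intro O a l' hl'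
    rw [h, List.nil_append]
    refine (size_flatMap_le _ l' _ fun b hb => (hB O (a, b)).trans
      (eval_mono B (show _ ≤ (enc a).size + (enc (l O a)).size + 1 + totalCoins O from ?_))).trans ?_
    · have h1 := size_mem_le (hl'.subset hb)
      simp only [enc_pair, Data.size]
      omega
    · have h1 := (length_le_size l').trans (size_prefix_le hl')
      gcongr

theorem map {f : (ι → Gate) → α → β → γ} {l : (ι → Gate) → α → List β}
    (hf : FP fun O (a : α × β) => f O a.1 a.2) (hl : FP l) :
    FP fun O a => (l O a).map (f O a) :=
  (flatMap (f := fun O a b => [f O a b]) (cons hf nil) hl).recode fun O a =>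
    ⟨a, rfl, by rw [List.map_eq_flatMap]⟩

theorem ones {n : (ι → Gate) → α → ℕ} (hn : FP n) : FP fun O a => List.replicate (n O a) true :=
  hn.recode fun _ a => ⟨a, rfl, enc_nat_replicate _⟩

theorem ofOnes {n : (ι → Gate) → α → ℕ} (hn : FP fun O a => List.replicate (n O a) true) : FP n :=
  hn.recode fun _ a => ⟨a, rfl, (enc_nat_replicate _).symm⟩

theorem length {l : (ι → Gate) → α → List β} (hl : FP l) : FP fun O a => (l O a).length :=
  ofOnes ((map (f := fun _ _ _ => true) (const true) hl).recode fun _ a => ⟨a, rfl, by simp⟩)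

theorem replicate {n : (ι → Gate) → α → ℕ} (hn : FP n) (b : β) :
    FP fun O a => List.replicate (n O a) b :=
  (map (f := fun _ _ _ => b) (const b) hn.ones).recode fun _ a => ⟨a, rfl, by simp⟩

theorem drop {n : (ι → Gate) → α → ℕ} {l : (ι → Gate) → α → List β} (hn : FP n) (hl : FP l) :
    FP fun O a => (l O a).drop (n O a) := by
  have h (l' : List Bool) (s : List β) : l'.foldl (fun s _ => s.tail) s = s.drop l'.length := by
    induction l' generalizing s with
    | nil => rfl
    | cons b l' ih => simp [ih]
  refine (foldl' (f := fun _ _ s _ => s.tail) id.snd.fst.tail hn.ones hl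
    (PolyBdd.size hl) fun O a l' _ => ?_).recode fun O a => ⟨a, rfl, by simp [h]⟩
  rw [h]
  exact size_suffix_le (List.drop_suffix _ _)

theorem add {n k : (ι → Gate) → α → ℕ} (hn : FP n) (hk : FP k) : FP fun O a => n O a + k O a :=
  ofOnes ((hn.ones.append hk.ones).recode fun _ a => ⟨a, rfl, by simp⟩)

theorem sub {n k : (ι → Gate) → α → ℕ} (hn : FP n) (hk : FP k) : FP fun O a => n O a - k O a :=
  ofOnes ((drop hk hn.ones).recode fun _ a => ⟨a, rfl, by simp⟩)

theorem mul {n k : (ι → Gate) → α → ℕ} (hn : FP n) (hk : FP k) : FP fun O a => n O a * k O a :=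
  ofOnes ((flatMap (f := fun O a _ => List.replicate (k O a) true)
    ((ones hk).comp id.fst) hn.ones).recode fun _ a => ⟨a, rfl, by
      simp [List.flatMap_replicate]⟩)

theorem pow {n : (ι → Gate) → α → ℕ} (hn : FP n) (j : ℕ) : FP fun O a => n O a ^ j := by
  induction j with
  | zero => exact const 1
  | succ j ih => exact mul ih hn

theorem polyEval {n : (ι → Gate) → α → ℕ} (hn : FP n) (P : Polynomial ℕ) :
    FP fun O a => P.eval (n O a) := by
  induction P using Polynomial.induction_on' with
  | add P Q hP hQ => simpa only [Polynomial.eval_add] using add hP hQ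
  | monomial j c => simpa only [Polynomial.eval_monomial] using mul (const c) (pow hn j)

theorem sum {κ : Type} (s : Finset κ) {n : (ι → Gate) → α → κ → ℕ}
    (hn : ∀ j, FP fun O a => n O a j) : FP fun O a => ∑ j ∈ s, n O a j := by
  classical
  induction s using Finset.induction_on with
  | empty => simpa using const 0
  | insert j s hj ih => simpa only [Finset.sum_insert hj] using add (hn j) ih

theorem take {n : (ι → Gate) → α → ℕ} {l : (ι → Gate) → α → List β} (hn : FP n) (hl : FP l) :
    FP fun O a => (l O a).take (n O a) :=
  (reverse (drop (sub hl.length hn) hl.reverse)).recode fun O a => ⟨a, rfl, by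
    rw [List.drop_reverse, List.reverse_reverse]
    congr 1
    rcases le_total (n O a) (l O a).length with h | h
    · rw [Nat.sub_sub_self h]
    · simp [Nat.sub_eq_zero_of_le h, List.take_of_length_le h]⟩

theorem lt {n k : (ι → Gate) → α → ℕ} (hn : FP n) (hk : FP k) :
    FP fun O a => decide (n O a < k O a) :=
  (comp truthy (toData (sub hk hn))).recode
    fun O a => ⟨a, rfl, by
      congr 1
      rw [enc_nat]
      by_cases h : n O a < k O a
      · obtain ⟨c, hc⟩ : ∃ c, k O a - n O a = c + 1 := ⟨k O a - n O a - 1, by omega⟩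
        rw [hc, Data.unary_succ]
        simp [h, Data.truthy]
      · rw [Nat.sub_eq_zero_of_le (by omega)]
        simp [h, Data.truthy, Data.unary, Data.ofBits]⟩

theorem and {b c : (ι → Gate) → α → Bool} (hb : FP b) (hc : FP c) : FP fun O a => b O a && c O a :=
  (ite hb hc (const false)).recode fun O a => ⟨a, rfl, by cases b O a <;> simp⟩

theorem not {b : (ι → Gate) → α → Bool} (hb : FP b) : FP fun O a => !b O a :=
  (ite hb (const false) (const true)).recode fun O a => ⟨a, rfl, by cases b O a <;> simp⟩

theorem countP {f : (ι → Gate) → α → β → Bool} {l : (ι → Gate) → α → List β}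
    (hf : FP fun O (a : α × β) => f O a.1 a.2) (hl : FP l) :
    FP fun O a => (l O a).countP (f O a) :=
  (length (flatMap (f := fun O a b => if f O a b then [true] else [])
    (ite hf (const [true]) nil) hl)).recode fun O a => ⟨a, rfl, by
      congr 1
      induction l O a with
      | nil => rfl
      | cons b l ih => cases h : f O a b <;> simp [h, ih]⟩

theorem range {n : (ι → Gate) → α → ℕ} (hn : FP n) : FP fun O a => List.range (n O a) := by
  have h (j : ℕ) : (List.replicate j true).foldl (fun s _ => s ++ [s.length]) [] =
      List.range j := by
    induction j with
    | zero => rfl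
    | succ j ih => rw [List.replicate_succ', List.foldl_append, ih, List.range_succ]; simp
  refine (foldl' (f := fun _ _ s _ => s ++ [s.length]) (s := fun _ _ => [])
    (b := fun O a => n O a * (4 * n O a + 2) + 1)
    (append id.snd.fst (cons id.snd.fst.length nil)) hn.ones nil ?_ ?_).recode
    fun O a => ⟨a, rfl, by rw [h]⟩
  · have hb : PolyBdd n := (PolyBdd.size hn).mono fun O a => by rw [size_enc_nat]; omega
    exact (hb.mul (((PolyBdd.const 4).mul hb).add (.const 2))).add (.const 1)
  · intro O a l' hl'
    obtain ⟨h1, h2⟩ := List.prefix_replicate_iff.1 hl'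
    rw [h2, h]
    refine (size_enc_list_le _ (4 * n O a + 1) fun j hj => ?_).trans ?_
    · have := List.mem_range.1 hj
      rw [size_enc_nat]; omega
    · rw [List.length_range]; gcongr

/-- The list of the immediate right-spine components of a tree. -/
def _root_.CRZK.Data.spine : Data → List Data
  | .nil => []
  | .cons a b => a :: b.spine

/-- Every tree encodes the list of its spine components, so list operations apply to raw data at no
cost. -/
theorem enc_spine (d : Data) : enc d.spine = d := by
  induction d with
  | nil => rfl
  | cons a b _ ih => rw [Data.spine, enc_list_cons, ih]; rfl

theorem toBits {f : (ι → Gate) → α → Data} (hf : FP f) : FP fun O a => (f O a).toBits := by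
  have h : FP fun O a => (f O a).spine := hf.recode fun O a => ⟨a, rfl, (enc_spine _).symm⟩
  refine (map (f := fun _ _ d => d.truthy) (truthy.comp id.snd) h).recode
    fun O a => ⟨a, rfl, ?_⟩
  congr 1
  induction f O a with
  | nil => rfl
  | cons a b _ ih => simp only [Data.spine, List.map_cons, ih, Data.toBits]

theorem toMsgs {f : (ι → Gate) → α → Data} (hf : FP f) : FP fun O a => (f O a).toMsgs := by
  have h : FP fun O a => (f O a).spine := hf.recode fun O a => ⟨a, rfl, (enc_spine _).symm⟩
  refine (map (f := fun _ _ d => d.toBits) (toBits id.snd) h).recode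
    fun O a => ⟨a, rfl, ?_⟩
  congr 1
  induction f O a with
  | nil => rfl
  | cons a b _ ih => simp only [Data.spine, List.map_cons, ih, Data.toMsgs]

theorem ofBits {f : (ι → Gate) → α → List Bool} (hf : FP f) :
    FP fun O a => Data.ofBits (f O a) :=
  hf.recode fun _ a => ⟨a, rfl, enc_bits _⟩

theorem ofMsgs {f : (ι → Gate) → α → List (List Bool)} (hf : FP f) :
    FP fun O a => Data.ofMsgs (f O a) :=
  hf.recode fun _ a => ⟨a, rfl, enc_msgs _⟩

theorem dataCons {f g : (ι → Gate) → α → Data} (hf : FP f) (hg : FP g) :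
    FP fun O a => Data.cons (f O a) (g O a) :=
  (hf.pair hg).recode fun _ a => ⟨a, rfl, rfl⟩

theorem evalProg {p : Prog Empty} (hp : p.PolyTime) {f : (ι → Gate) → α → Data} (hf : FP f) :
    FP fun O a => p.eval noOracle (f O a) := by
  refine comp (g := fun _ d => p.eval noOracle d) ?_ hf
  obtain ⟨T, hT⟩ := hp
  refine ⟨p.lift, T, fun O d => ?_⟩
  obtain ⟨b, t, h1, h2⟩ := hT noOracle d
  refine ⟨t, ?_, h2.trans (eval_mono T (by simp [totalCoins, enc_data]))⟩
  change p.lift.Runs O d (p.eval noOracle d) t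
  rw [h1.eval_eq]
  exact h1.lift

theorem runPPT (M : PPT) {f : (ι → Gate) → α → Data} {ρ : (ι → Gate) → α → List Bool}
    (hf : FP f) (hρ : FP ρ) : FP fun O a => M.run noOracle (f O a) (ρ O a) :=
  evalProg M.polyTime (dataCons hf hρ.ofBits)

theorem gateCoins (j : ι) : FP fun (O : ι → Gate) (_ : α) => (O j).coins :=
  prim (p := .coins j) 5 fun O a => ⟨_, .coins j _, by
    have h1 : (O j).coins ≤ totalCoins O :=
      Finset.single_le_sum (f := fun j => (O j).coins) (fun _ _ => Nat.zero_le _)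
        (Finset.mem_univ j)
    have h2 := (enc a).one_le_size
    rw [Data.size_unary]
    omega⟩

theorem gateQuery (j : ι) {n : (ι → Gate) → α → ℕ} {q : (ι → Gate) → α → Data}
    {ρ : (ι → Gate) → α → List Bool} (hn : FP n) (hq : FP q) (hρ : FP ρ) :
    FP fun O a => ((O j).answer (q O a) (ρ O a)).take (n O a) :=
  comp (g := fun O (b : ℕ × Data × List Bool) => ((O j).answer b.2.1 b.2.2).take b.1)
    (prim (p := .query j) 2 fun O b => by
      have h := Prog.Runs.query (O := O) j (enc b)
      have e1 : (enc b).fst.toBits.length = b.1 := Data.length_toBits_unary b.1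
      have e2 : (enc b).snd.fst = b.2.1 := rfl
      have e3 : (enc b).snd.snd.toBits = b.2.2 := by
        show (enc b.2.2).toBits = _
        rw [enc_bits, Data.toBits_ofBits]
      rw [e1, e2, e3] at h
      rw [enc_bits]
      refine ⟨_, h, ?_⟩
      have h1 := Data.size_ofBits_le (((O j).answer b.2.1 b.2.2).take b.1)
      have h2 := List.length_take_le b.1 ((O j).answer b.2.1 b.2.2)
      have h3 : (enc b).size = 4 * b.1 + 1 + (enc b.2).size + 1 := by
        rw [← size_enc_nat]; rfl
      omega) (hn.pair (hq.pair hρ))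

end FP
end CRZK

/-! ### Construction of the reduction -/

namespace CRZK
open Enc

/-- The first `n` blocks of length `c` of a string. -/
def chunks (c n : ℕ) (σ : List Bool) : List (List Bool) :=
  (List.range n).map fun j => (σ.drop (j * c)).take c

/-- An element of `l` with maximal score. -/
def select (score : List Bool → ℕ) (l : List (List Bool)) : List Bool :=
  l.foldl (fun b π => if score b < score π then π else b) []

/-- A self-delimiting code for lists of bit strings of known length. -/
def code (l : List (List Bool)) : List Bool :=
  l.flatMap fun m => (m.flatMap fun b => [true, b]) ++ [false]

/-- Truncation or padding to length `n`. -/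
def padTo (n : ℕ) (l : List Bool) : List Bool :=
  (l ++ List.replicate n false).take n

/-- A public-coin protocol and a simulator, together with the parameters of the reduction: the
number of inversion attempts per round, the number of samples per estimate, and the output length
of the function families in terms of their input length. -/
structure Scheme (k : ℕ) where
  V : Verifier k
  Sim : PPT
  tries : Polynomial ℕ
  samples : Polynomial ℕ
  width : Polynomial ℕ
  pos : 0 < k

namespace Scheme

variable {k : ℕ} (S : Scheme k) (G : Fin k → Gate) (x : List Bool)

/-- The round that is played next when `d + 1` rounds are left. -/
def round (d : ℕ) : Fin k := ⟨k - (d + 1), by have := S.pos; omega⟩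

/-- The messages of the simulated transcript. -/
noncomputable def simMsgs (u : List Bool) : List (List Bool) :=
  (S.Sim.run noOracle (.ofBits x) (u.take (S.Sim.coins.eval x.length))).toMsgs

/-- In the last round: whether the simulated transcript is accepting. -/
noncomputable def flag (i : ℕ) (u : List Bool) : Bool :=
  if decide (i + 1 < k) then true else S.V.accepts x ((S.simMsgs x u).takeD (2 * k) [])

/-- The function to be inverted in round `i`. -/
noncomputable def image (i : ℕ) (u : List Bool) : List Bool :=
  padTo (S.width.eval u.length) (code ([S.flag x i u] :: (S.simMsgs x u).takeD (2 * i + 1) []))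

/-- Input length of the function families. -/
noncomputable def domLen : Polynomial ℕ := S.Sim.coins + .X

/-- Input length of the function of round `i`, in terms of the gates of the later rounds. -/
noncomputable def seedLen (i : Fin k) : ℕ :=
  S.domLen.eval (x.length + totalCoins fun j : {j : Fin k // i < j} => G j)

/-- The point at which the prover of the reduction inverts after the messages `t`. -/
noncomputable def target (i : Fin k) (t : List (List Bool)) : List Bool :=
  padTo (S.width.eval (S.seedLen G x i)) (code ([true] :: t))

/-- The message obtained from one inversion attempt. -/
noncomputable def reply (i : Fin k) (t : List (List Bool)) (α : List Bool) : List Bool :=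
  (S.simMsgs x ((G i).answer (.cons (.ofBits x) (.ofBits (S.target G x i t))) α)).getD
    (2 * i + 1) []

/-- Number of coins used to play `d` rounds. -/
noncomputable def playCoins : ℕ → ℕ
  | 0 => 0
  | d + 1 => S.V.coinLen (S.round d) x.length +
      ((S.tries.eval x.length * (G (S.round d)).coins + S.samples.eval x.length * playCoins d) +
        playCoins d)

/-- Number of coins of the prover's move when `d` rounds are left afterwards. -/
noncomputable def moveCoins (d : ℕ) : ℕ :=
  S.tries.eval x.length * (G (S.round d)).coins + S.samples.eval x.length * S.playCoins G x d

/-- Number of successful continuations `f` after the transcript `t`. -/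
noncomputable def count (f : List (List Bool) → List Bool → Bool) (d : ℕ) (ω : List Bool)
    (t : List (List Bool)) : ℕ :=
  (chunks (S.playCoins G x d) (S.samples.eval x.length) ω).countP (f t)

/-- Among several inversion attempts, a message with the best estimated success probability. -/
noncomputable def pick (f : List (List Bool) → List Bool → Bool) (d : ℕ) (t : List (List Bool))
    (α ω : List Bool) : List Bool :=
  select (fun π => S.count G x f d ω (t ++ [π]))
    ((chunks (G (S.round d)).coins (S.tries.eval x.length) α).map (S.reply G x (S.round d) t))

/-- `pick`, with its coins given as a single string. -/
noncomputable def pickSplit (f : List (List Bool) → List Bool → Bool) (d : ℕ)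
    (t : List (List Bool)) (μ : List Bool) : List Bool :=
  S.pick G x f d t (μ.take (S.tries.eval x.length * (G (S.round d)).coins))
    (μ.drop (S.tries.eval x.length * (G (S.round d)).coins))

/-- The verdict after `d` more rounds, played between the honest verifier and the prover that
inverts the function families. -/
noncomputable def play : ℕ → List (List Bool) → List Bool → Bool
  | 0, t, _ => S.V.accepts x t
  | d + 1, t, σ =>
    play d
      ((t ++ [σ.take (S.V.coinLen (S.round d) x.length)]) ++
        [S.pickSplit G x (play d) d (t ++ [σ.take (S.V.coinLen (S.round d) x.length)])
          ((σ.drop (S.V.coinLen (S.round d) x.length)).take (S.moveCoins G x d))])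
      ((σ.drop (S.V.coinLen (S.round d) x.length)).drop (S.moveCoins G x d))

/-- The prover's move when `d` rounds are left afterwards. -/
noncomputable def move (d : ℕ) (t : List (List Bool)) (μ : List Bool) : List Bool :=
  S.pickSplit G x (S.play G x d) d t μ

end Scheme

/-! ### Running time of the reduction -/

namespace FP

section

variable {ι α β : Type} [Fintype ι] [Enc α] [Enc β]

theorem chunks {c n : (ι → Gate) → α → ℕ} {σ : (ι → Gate) → α → List Bool} (hc : FP c) (hn : FP n)
    (hσ : FP σ) : FP fun O a => chunks (c O a) (n O a) (σ O a) :=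
  map (f := fun O a j => ((σ O a).drop (j * c O a)).take (c O a))
    (take (hc.comp id.fst) (drop (mul id.snd (hc.comp id.fst)) (hσ.comp id.fst))) (range hn)

theorem code {l : (ι → Gate) → α → List (List Bool)} (hl : FP l) : FP fun O a => code (l O a) := by
  have h : FP fun (_ : ι → Gate) (a : α × List Bool) => a.2.flatMap fun b => [true, b] :=
    flatMap (f := fun _ _ b => [true, b]) (cons (const true) (cons id.snd nil)) id.snd
  exact flatMap (f := fun _ _ m => (m.flatMap fun b => [true, b]) ++ [false])
    (append h (const [false])) hl

theorem padTo {n : (ι → Gate) → α → ℕ} {l : (ι → Gate) → α → List Bool} (hn : FP n) (hl : FP l) :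
    FP fun O a => padTo (n O a) (l O a) :=
  take hn (append hl (replicate hn false))

theorem select {f : (ι → Gate) → α → List Bool → ℕ} {l : (ι → Gate) → α → List (List Bool)}
    (hf : FP fun O (a : α × List Bool) => f O a.1 a.2) (hl : FP l) :
    FP fun O a => select (f O a) (l O a) := by
  have h (g : List Bool → ℕ) (l' : List (List Bool)) (s : List Bool) :
      l'.foldl (fun b π => if g b < g π then π else b) s ∈ s :: l' := by
    induction l' generalizing s with
    | nil => simp
    | cons b l' ih =>
      have := ih (if g s < g b then b else s)
      simp only [List.foldl_cons]
      split_ifs at this ⊢ <;> simp only [List.mem_cons] at this ⊢ <;> tauto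
  refine (foldl' (f := fun O a b π => if decide (f O a b < f O a π) then π else b)
    (s := fun _ _ => []) (b := fun O a => (enc (l O a)).size + 1)
    (ite (lt (hf.comp (id.fst.pair id.snd.fst)) (hf.comp (id.fst.pair id.snd.snd)))
      id.snd.snd id.snd.fst) hl nil ((PolyBdd.size hl).add (.const 1)) ?_).recode
    fun O a => ⟨a, rfl, by simp [CRZK.select]⟩
  intro O a l' hl'
  have h1 := h (f O a) l' []
  simp only [decide_eq_true_eq]
  rcases List.mem_cons.1 h1 with h1 | h1
  · rw [h1, enc_list_nil, Data.size]; omega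
  · exact (size_mem_le (hl'.subset h1)).trans (by omega)

theorem coinLen {k : ℕ} (V : Verifier k) {i : ℕ} (hi : i < k) {n : (ι → Gate) → α → ℕ} (hn : FP n) :
    FP fun O a => V.coinLen i (n O a) := by
  obtain ⟨q, hq, h⟩ := V.coinLen_polyTime i hi
  exact (evalProg hq (toData hn)).recode fun O a => ⟨a, rfl, h _⟩

theorem accepts {k : ℕ} (V : Verifier k) {x : (ι → Gate) → α → List Bool}
    {t : (ι → Gate) → α → List (List Bool)} (hx : FP x) (ht : FP t) :
    FP fun O a => V.accepts (x O a) (t O a) :=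
  truthy.comp (evalProg V.polyTime (dataCons hx.ofBits ht.ofMsgs))

end

section Scheme

variable {ι α : Type} [Fintype ι] [Enc α] {k : ℕ} (S : Scheme k)
  {x u : (ι → Gate) → α → List Bool}

theorem simMsgs (hx : FP x) (hu : FP u) : FP fun O a => S.simMsgs (x O a) (u O a) :=
  toMsgs (runPPT S.Sim hx.ofBits (take (polyEval hx.length _) hu))

theorem image (i : ℕ) (hx : FP x) (hu : FP u) : FP fun O a => S.image (x O a) i (u O a) := by
  refine padTo (polyEval hu.length _) (code (cons (cons ?_ nil) (takeD (simMsgs S hx hu) _)))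
  exact ite (const _) (const true) (accepts S.V hx (takeD (simMsgs S hx hu) _))

/-- Uniformly polynomial-time gates, one family for each instance. -/
structure Gates (G : (ι → Gate) → List Bool → Fin k → Gate) : Prop where
  coins : ∀ j, FP fun O (x : List Bool) => (G O x j).coins
  answer : ∀ j, FP fun O (a : List Bool × ℕ × Data × List Bool) =>
    ((G O a.1 j).answer a.2.2.1 a.2.2.2).take a.2.1

variable {G : (ι → Gate) → List Bool → Fin k → Gate} (hG : Gates G)
include hG

theorem reply (i : Fin k) {t : (ι → Gate) → α → List (List Bool)} {ρ : (ι → Gate) → α → List Bool}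
    (hx : FP x) (ht : FP t) (hρ : FP ρ) :
    FP fun O a => S.reply (G O (x O a)) (x O a) i (t O a) (ρ O a) := by
  have hy : FP fun O a => S.target (G O (x O a)) (x O a) i (t O a) := by
    refine padTo (polyEval (polyEval (add hx.length ?_) _) _) (code (cons (const _) ht))
    exact sum Finset.univ fun j => (hG.coins j).comp hx
  -- A gate's answer may be too long to read, but the simulator looks only at its first `Sim.coins`
  -- bits, so a truncated query suffices.
  have h := (hG.answer i).comp (hx.pair ((polyEval hx.length S.Sim.coins).pair
    ((dataCons hx.ofBits hy.ofBits).pair hρ)))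
  refine getD (toMsgs ?_) _
  exact runPPT S.Sim hx.ofBits h

theorem playCoins (d : ℕ) (hx : FP x) : FP fun O a => S.playCoins (G O (x O a)) (x O a) d := by
  induction d with
  | zero => exact const 0
  | succ d ih =>
    exact add (coinLen S.V (S.round d).2 hx.length) (add (add (mul (polyEval hx.length _)
      ((hG.coins _).comp hx)) (mul (polyEval hx.length _) ih)) ih)

theorem moveCoins (d : ℕ) (hx : FP x) : FP fun O a => S.moveCoins (G O (x O a)) (x O a) d :=
  add (mul (polyEval hx.length _) ((hG.coins _).comp hx))
    (mul (polyEval hx.length _) (playCoins S hG d hx))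

variable {f : (ι → Gate) → List Bool → List (List Bool) → List Bool → Bool}
  (hf : FP fun O (a : List Bool × List (List Bool) × List Bool) => f O a.1 a.2.1 a.2.2)
include hf

theorem count (d : ℕ) {t : (ι → Gate) → α → List (List Bool)} {ω : (ι → Gate) → α → List Bool}
    (hx : FP x) (ht : FP t) (hω : FP ω) :
    FP fun O a => S.count (G O (x O a)) (x O a) (f O (x O a)) d (ω O a) (t O a) :=
  countP (f := fun O a => f O (x O a) (t O a))
    (hf.comp ((hx.comp id.fst).pair ((ht.comp id.fst).pair id.snd)))
    (chunks (playCoins S hG d hx) (polyEval hx.length _) hω)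

theorem pick (d : ℕ) {t : (ι → Gate) → α → List (List Bool)} {ρ ω : (ι → Gate) → α → List Bool}
    (hx : FP x) (ht : FP t) (hρ : FP ρ) (hω : FP ω) :
    FP fun O a => S.pick (G O (x O a)) (x O a) (f O (x O a)) d (t O a) (ρ O a) (ω O a) :=
  select (f := fun O a π => S.count (G O (x O a)) (x O a) (f O (x O a)) d (ω O a) (t O a ++ [π]))
    (count S hG hf d (hx.comp id.fst) (append (ht.comp id.fst) (cons id.snd nil))
      (hω.comp id.fst))
    (map (f := fun O a => S.reply (G O (x O a)) (x O a) (S.round d) (t O a))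
      (reply S hG _ (hx.comp id.fst) (ht.comp id.fst) id.snd)
      (chunks ((hG.coins _).comp hx) (polyEval hx.length _) hρ))

theorem pickSplit (d : ℕ) {t : (ι → Gate) → α → List (List Bool)} {μ : (ι → Gate) → α → List Bool}
    (hx : FP x) (ht : FP t) (hμ : FP μ) :
    FP fun O a => S.pickSplit (G O (x O a)) (x O a) (f O (x O a)) d (t O a) (μ O a) :=
  pick S hG hf d hx ht (take (mul (polyEval hx.length _) ((hG.coins _).comp hx)) hμ)
    (drop (mul (polyEval hx.length _) ((hG.coins _).comp hx)) hμ)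

omit hf

/-- The recursion is unrolled into the program, so the bound is polynomial for each fixed `d` only.
With abstract `Gates` the result serves twice: with real oracles for the reduction, and with the
inverters inlined for distinguishers and cheating provers. -/
theorem play (d : ℕ) : FP fun O (a : List Bool × List (List Bool) × List Bool) =>
    S.play (G O a.1) a.1 d a.2.1 a.2.2 := by
  induction d with
  | zero => exact accepts S.V id.fst id.snd.fst
  | succ d ih =>
    have hx : FP fun (_ : ι → Gate) (a : List Bool × List (List Bool) × List Bool) => a.1 := id.fst
    have ht : FP fun (_ : ι → Gate) (a : List Bool × List (List Bool) × List Bool) => a.2.1 :=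
      id.snd.fst
    have hσ : FP fun (_ : ι → Gate) (a : List Bool × List (List Bool) × List Bool) => a.2.2 :=
      id.snd.snd
    have hℓ := coinLen S.V (S.round d).2 hx.length
    have ht' := append ht (cons (take hℓ hσ) nil)
    have hd := drop hℓ hσ
    have hm := moveCoins S hG d hx
    exact ih.comp (hx.pair ((append ht' (cons (pickSplit S hG
      (f := fun O x => S.play (G O x) x d) ih d hx ht' (take hm hd)) nil)).pair
      (drop hm hd)))

theorem move (d : ℕ) {t : (ι → Gate) → α → List (List Bool)} {μ : (ι → Gate) → α → List Bool}
    (hx : FP x) (ht : FP t) (hμ : FP μ) :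
    FP fun O a => S.move (G O (x O a)) (x O a) d (t O a) (μ O a) :=
  pickSplit S hG (f := fun O x => S.play (G O x) x d) (play S hG d) d hx ht hμ

end Scheme

end FP
end CRZK

namespace CRZK
open scoped ENNReal

/-! ### Expectations -/

/-- Expectation of a nonnegative function. -/
noncomputable def ex {α : Type} (X : PMF α) (f : α → ℝ≥0∞) : ℝ≥0∞ := ∑' a, X a * f a

/-- Indicator of a bit. -/
def ind (b : Bool) : ℝ≥0∞ := if b then 1 else 0

@[simp] theorem ind_true : ind true = 1 := rfl
@[simp] theorem ind_false : ind false = 0 := rfl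

theorem ind_le_one (b : Bool) : ind b ≤ 1 := by cases b <;> simp

section ex

variable {α β : Type} (X : PMF α) (Y : PMF β)

theorem ex_pure (a : α) (f : α → ℝ≥0∞) : ex (PMF.pure a) f = f a := by
  classical
  rw [ex, tsum_eq_single a fun b hb => by simp [PMF.pure_apply, hb]]
  simp

theorem ex_bind (K : α → PMF β) (f : β → ℝ≥0∞) : ex (X.bind K) f = ex X fun a => ex (K a) f := by
  simp only [ex, PMF.bind_apply, ← ENNReal.tsum_mul_right, ← ENNReal.tsum_mul_left]
  rw [ENNReal.tsum_comm]
  simp only [mul_assoc]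

theorem ex_map (g : α → β) (f : β → ℝ≥0∞) : ex (X.map g) f = ex X fun a => f (g a) := by
  rw [← PMF.bind_pure_comp, ex_bind]
  simp only [Function.comp, ex_pure]

variable {X} in
theorem ex_mono {f g : α → ℝ≥0∞} (h : ∀ a, f a ≤ g a) : ex X f ≤ ex X g :=
  ENNReal.tsum_le_tsum fun a => by gcongr; exact h a

theorem ex_add (f g : α → ℝ≥0∞) : (ex X fun a => f a + g a) = ex X f + ex X g := by
  simp only [ex, mul_add, ENNReal.tsum_add]

theorem ex_const (c : ℝ≥0∞) : (ex X fun _ => c) = c := by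
  simp [ex, ENNReal.tsum_mul_right, X.tsum_coe]

theorem ex_const_mul (c : ℝ≥0∞) (f : α → ℝ≥0∞) : (ex X fun a => c * f a) = c * ex X f := by
  simp only [ex, mul_left_comm _ c, ENNReal.tsum_mul_left]

theorem ex_mul_const (c : ℝ≥0∞) (f : α → ℝ≥0∞) : (ex X fun a => f a * c) = ex X f * c := by
  simp only [ex, ← mul_assoc, ENNReal.tsum_mul_right]

theorem ex_sum {κ : Type} (s : Finset κ) (f : κ → α → ℝ≥0∞) :
    (ex X fun a => ∑ j ∈ s, f j a) = ∑ j ∈ s, ex X (f j) := by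
  classical
  induction s using Finset.induction_on with
  | empty => simpa using ex_const X 0
  | insert j s hj ih => simp only [Finset.sum_insert hj, ex_add, ih]

theorem ex_comm (f : α → β → ℝ≥0∞) :
    (ex X fun a => ex Y (f a)) = ex Y fun b => ex X fun a => f a b := by
  simp only [ex, ← ENNReal.tsum_mul_left]
  rw [ENNReal.tsum_comm]
  simp only [mul_left_comm]

variable {X} in
theorem ex_le_const {f : α → ℝ≥0∞} {c : ℝ≥0∞} (h : ∀ a, f a ≤ c) : ex X f ≤ c :=
  (ex_mono h).trans_eq (ex_const X c)

theorem prob_eq (E : α → Bool) : prob X E = (ex X fun a => ind (E a)).toReal := by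
  rw [prob]
  congr 1
  rw [PMF.map_apply, ex]
  refine tsum_congr fun a => ?_
  cases E a <;> simp

theorem prob_nonneg (E : α → Bool) : 0 ≤ prob X E := ENNReal.toReal_nonneg

theorem ex_ne_top {f : α → ℝ≥0∞} (h : ∀ a, f a ≤ 1) : ex X f ≠ ⊤ :=
  ((ex_le_const h).trans_lt ENNReal.one_lt_top).ne

theorem ofReal_prob (E : α → Bool) : ENNReal.ofReal (prob X E) = ex X fun a => ind (E a) := by
  rw [prob_eq, ENNReal.ofReal_toReal (ex_ne_top X fun a => ind_le_one _)]

end ex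

/-- Functions with values in `[0, 1]` distinguish at most as well as the statistical distance. -/
theorem ex_le_add_statDist {α : Type} (X Y : PMF α) {f : α → ℝ≥0∞} (hf : ∀ a, f a ≤ 1) :
    ex X f ≤ ex Y f + ENNReal.ofReal (statDist X Y) := by
  have hX : Summable fun a => (X a).toReal := ENNReal.summable_toReal X.tsum_coe_ne_top
  have hY : Summable fun a => (Y a).toReal := ENNReal.summable_toReal Y.tsum_coe_ne_top
  have hX1 : ∑' a, (X a).toReal = 1 := by
    rw [← ENNReal.tsum_toReal_eq fun a => X.apply_ne_top a, X.tsum_coe, ENNReal.toReal_one]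
  have hY1 : ∑' a, (Y a).toReal = 1 := by
    rw [← ENNReal.tsum_toReal_eq fun a => Y.apply_ne_top a, Y.tsum_coe, ENNReal.toReal_one]
  have hD : Summable fun a => (X a).toReal - (Y a).toReal := hX.sub hY
  have hpos : Summable fun a => (|(X a).toReal - (Y a).toReal| +
      ((X a).toReal - (Y a).toReal)) / 2 := (hD.abs.add hD).div_const 2
  -- Both total masses are 1, so the differences sum to 0 and the positive parts sum to half of the
  -- `ℓ¹` distance.
  have h1 : ENNReal.ofReal (statDist X Y) = ∑' a, ENNReal.ofReal
      ((|(X a).toReal - (Y a).toReal| + ((X a).toReal - (Y a).toReal)) / 2) := by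
    rw [← ENNReal.ofReal_tsum_of_nonneg (fun a => ?_) hpos, statDist, tsum_div_const,
      hD.abs.tsum_add hD, hX.tsum_sub hY, hX1, hY1]
    · simp
    · have := neg_abs_le ((X a).toReal - (Y a).toReal)
      linarith
  rw [h1, ex, ex, ← ENNReal.tsum_add]
  refine ENNReal.tsum_le_tsum fun a => ?_
  have h2 : X a ≤ Y a + ENNReal.ofReal
      ((|(X a).toReal - (Y a).toReal| + ((X a).toReal - (Y a).toReal)) / 2) := by
    rw [← ENNReal.ofReal_toReal (X.apply_ne_top a), ← ENNReal.ofReal_toReal (Y.apply_ne_top a),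
      ← ENNReal.ofReal_add ENNReal.toReal_nonneg]
    · simp only [ENNReal.toReal_ofReal ENNReal.toReal_nonneg]
      apply ENNReal.ofReal_le_ofReal
      have := le_abs_self ((X a).toReal - (Y a).toReal)
      linarith
    · simp only [ENNReal.toReal_ofReal ENNReal.toReal_nonneg]
      have := neg_abs_le ((X a).toReal - (Y a).toReal)
      linarith
  calc X a * f a ≤ _ := mul_le_mul_left h2 (f a)
    _ = Y a * f a + _ * f a := add_mul _ _ _
    _ ≤ _ := by
      gcongr
      exact mul_le_of_le_one_right' (hf a)

/-! ### Uniform strings -/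

theorem ex_unif (n : ℕ) (f : List Bool → ℝ≥0∞) :
    ex (unif n) f = (∑ v : Fin n → Bool, f (List.ofFn v)) * ((2 : ℝ≥0∞) ^ n)⁻¹ := by
  rw [unif, ex_map, ex, tsum_fintype, Finset.sum_mul]
  refine Finset.sum_congr rfl fun v _ => ?_
  simp [PMF.uniformOfFintype_apply, mul_comm]

theorem ex_unif_zero (f : List Bool → ℝ≥0∞) : ex (unif 0) f = f [] := by
  simp [ex_unif]

theorem ex_unif_add (a b : ℕ) (f : List Bool → ℝ≥0∞) :
    ex (unif (a + b)) f = ex (unif a) fun l => ex (unif b) fun l' => f (l ++ l') := by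
  simp only [ex_unif]
  rw [← (Fin.appendEquiv a b).sum_comp, Fintype.sum_prod_type, ← Finset.sum_mul, mul_assoc,
    pow_add, ENNReal.mul_inv (by simp) (by simp), mul_comm ((2 : ℝ≥0∞) ^ a)⁻¹]
  simp only [Fin.appendEquiv, Equiv.coe_fn_mk, List.ofFn_fin_append]

theorem ex_unif_congr {n : ℕ} {f g : List Bool → ℝ≥0∞} (h : ∀ l, l.length = n → f l = g l) :
    ex (unif n) f = ex (unif n) g := by
  simp only [ex_unif]
  congr 1
  exact Finset.sum_congr rfl fun v _ => h _ (by simp)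

theorem ex_unif_le {n : ℕ} {f g : List Bool → ℝ≥0∞} (h : ∀ l, l.length = n → f l ≤ g l) :
    ex (unif n) f ≤ ex (unif n) g := by
  simp only [ex_unif]
  gcongr with v
  exact h _ (by simp)

/-- Surplus coins are harmless. This lets an algorithm draw a polynomial number of coins and use a
prefix of exactly the required length. -/
theorem ex_unif_take {n C : ℕ} (h : n ≤ C) (f : List Bool → ℝ≥0∞) :
    (ex (unif C) fun l => f (l.take n)) = ex (unif n) f := by
  obtain ⟨b, rfl⟩ := Nat.exists_eq_add_of_le h
  rw [ex_unif_add]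
  refine ex_unif_congr fun l hl => ?_
  subst hl
  simp only [List.take_left, ex_const]

theorem chunks_zero (c : ℕ) (σ : List Bool) : chunks c 0 σ = [] := rfl

theorem chunks_succ (n : ℕ) (l σ : List Bool) :
    chunks l.length (n + 1) (l ++ σ) = l :: chunks l.length n σ := by
  simp only [chunks, List.range_succ_eq_map, List.map_cons, List.map_map]
  congr 1
  · simp
  · refine List.map_congr_left fun j _ => ?_
    simp only [Function.comp, Nat.succ_mul]
    rw [add_comm, ← List.drop_drop, List.drop_left]

/-- Disjoint blocks of a uniform string are independent and uniform, so the probability that all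
inversion attempts fail is a power. -/
theorem ex_chunks_prod (c n : ℕ) (g : List Bool → ℝ≥0∞) :
    (ex (unif (n * c)) fun σ => ((chunks c n σ).map g).prod) = ex (unif c) g ^ n := by
  induction n with
  | zero => simp [chunks_zero, ex_const]
  | succ n ih =>
    rw [Nat.succ_mul, add_comm, ex_unif_add, pow_succ', ← ex_mul_const]
    refine ex_unif_congr fun l hl => ?_
    subst hl
    simp only [chunks_succ, List.map_cons, List.prod_cons, ex_const_mul, ih]

theorem ex_chunks_sum (c n : ℕ) (g : List Bool → ℝ≥0∞) :
    (ex (unif (n * c)) fun σ => ((chunks c n σ).map g).sum) = n * ex (unif c) g := by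
  induction n with
  | zero => simp [chunks_zero, ex_const]
  | succ n ih =>
    rw [Nat.succ_mul, add_comm, ex_unif_add, Nat.cast_add, add_mul, Nat.cast_one, one_mul,
      add_comm ((n : ℝ≥0∞) * _), ← ex_const (unif c) (n * _), ← ex_add]
    refine ex_unif_congr fun l hl => ?_
    subst hl
    simp only [chunks_succ, List.map_cons, List.sum_cons, ex_add, ex_const, ih]

theorem countP_eq_sum {α : Type} (g : α → Bool) (l : List α) :
    (l.countP g : ℝ≥0∞) = (l.map fun a => ind (g a)).sum := by
  induction l with
  | nil => simp
  | cons a l ih => cases h : g a <;> simp [h, ← ih, add_comm]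

theorem ex_countP (c n : ℕ) (g : List Bool → Bool) :
    (ex (unif (n * c)) fun σ => ((chunks c n σ).countP g : ℝ≥0∞)) =
      n * ex (unif c) fun l => ind (g l) := by
  simp only [countP_eq_sum, ex_chunks_sum]

theorem ex_bool {α : Type} (X : PMF α) (g : α → Bool) (f : Bool → ℝ≥0∞) :
    (ex X fun a => f (g a)) = (ex X fun a => ind (g a)) * f true +
      (1 - ex X fun a => ind (g a)) * f false := by
  have h1 : (ex X fun a => ind (g a)) + (ex X fun a => ind (!g a)) = 1 := by
    rw [← ex_add, ← ex_const X 1]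
    congr 1; funext a; cases g a <;> simp
  have h2 : (1 - ex X fun a => ind (g a)) = ex X fun a => ind (!g a) := by
    rw [← h1, ENNReal.add_sub_cancel_left (ex_ne_top X fun a => ind_le_one _)]
  rw [h2, ← ex_mul_const, ← ex_mul_const, ← ex_add]
  congr 1; funext a; cases g a <;> simp

/-- Second moment of a binomial variable. -/
theorem ex_countP_sq (c n : ℕ) (g : List Bool → Bool) (z : ℝ) :
    (ex (unif (n * c)) fun σ => ENNReal.ofReal (((chunks c n σ).countP g + z) ^ 2)) =
      ENNReal.ofReal ((z + n * prob (unif c) g) ^ 2 +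
        n * (prob (unif c) g * (1 - prob (unif c) g))) := by
  set q := prob (unif c) g with hq
  have hq0 : 0 ≤ q := ENNReal.toReal_nonneg
  have hqe : (ex (unif c) fun l => ind (g l)) = ENNReal.ofReal q := (ofReal_prob _ _).symm
  have hq1 : q ≤ 1 := by
    rw [← ENNReal.ofReal_le_one, ← hqe]
    exact ex_le_const fun a => ind_le_one _
  have hv : 0 ≤ q * (1 - q) := mul_nonneg hq0 (by linarith)
  -- The first sample is absorbed into the shift `z`, hence the need for all shifts at once.
  induction n generalizing z with
  | zero => simp [chunks_zero, ex_const]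
  | succ n ih =>
    have h1 (b : Bool) (l : List Bool) (hl : l.length = c) (hb : g l = b) :
        (ex (unif (n * c)) fun σ =>
          ENNReal.ofReal (((chunks c (n + 1) (l ++ σ)).countP g + z) ^ 2)) =
        ENNReal.ofReal (((if b then 1 else 0) + z + n * q) ^ 2 + n * (q * (1 - q))) := by
      subst hl
      rw [← ih]
      congr 1; funext σ
      rw [chunks_succ, List.countP_cons, hb]
      congr 2
      cases b <;> simp; ring
    rw [Nat.succ_mul, add_comm (n * c), ex_unif_add, ex_unif_congr (fun l hl => h1 _ l hl rfl),
      ex_bool (unif c) g (fun b => ENNReal.ofReal (((if b then 1 else 0) + z + n * q) ^ 2 +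
        n * (q * (1 - q)))), hqe, ← ENNReal.ofReal_one, ← ENNReal.ofReal_sub _ hq0,
      ← ENNReal.ofReal_mul hq0, ← ENNReal.ofReal_mul (by linarith), ← ENNReal.ofReal_add]
    · congr 1
      push_cast
      simp only [if_true]
      ring
    · positivity
    · exact mul_nonneg (by linarith) (by positivity)

/-- An empirical mean of `M²` samples exceeds the true mean by at most `1 / (2M)` on average. -/
theorem ex_countP_excess (c M : ℕ) (hM : 0 < M) (g : List Bool → Bool) :
    (ex (unif (M ^ 2 * c)) fun σ => ((chunks c (M ^ 2) σ).countP g : ℝ≥0∞) / (M ^ 2 : ℕ) -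
      ex (unif c) fun l => ind (g l)) ≤ ENNReal.ofReal (1 / (2 * M)) := by
  have h2 := ex_countP_sq c (M ^ 2) g (-((M ^ 2 : ℕ) * prob (unif c) g))
  rw [← ofReal_prob]
  set q := prob (unif c) g with hq
  have hM' : (0 : ℝ) < M := by exact_mod_cast hM
  have hq0 : 0 ≤ q := ENNReal.toReal_nonneg
  -- For the deviation `y` of the mean, `y ≤ M y² + 1/(4M)` by completing the square. The
  -- expectation of `y²` is `q(1-q)/M² ≤ 1/(4M²)`, so the two terms add up to at most `1/(2M)`
  -- without any square root.
  have h1 (j : ℕ) : (j : ℝ≥0∞) / (M ^ 2 : ℕ) - ENNReal.ofReal q ≤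
      ENNReal.ofReal ((M : ℝ)⁻¹ ^ 3) * ENNReal.ofReal ((j + -((M ^ 2 : ℕ) * q)) ^ 2) +
        ENNReal.ofReal (1 / (4 * M)) := by
    have : (j : ℝ≥0∞) / (M ^ 2 : ℕ) = ENNReal.ofReal (j / (M ^ 2 : ℕ)) := by
      rw [ENNReal.ofReal_div_of_pos (by positivity), ENNReal.ofReal_natCast, ENNReal.ofReal_natCast]
    rw [this, ← ENNReal.ofReal_sub _ hq0, ← ENNReal.ofReal_mul (by positivity),
      ← ENNReal.ofReal_add (by positivity) (by positivity)]
    apply ENNReal.ofReal_le_ofReal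
    push_cast
    have e : (M : ℝ)⁻¹ ^ 3 * (j + -((M : ℝ) ^ 2 * q)) ^ 2 + 1 / (4 * M) - (j / (M : ℝ) ^ 2 - q) =
        M * ((j / (M : ℝ) ^ 2 - q) - 1 / (2 * M)) ^ 2 := by
      field_simp
      ring
    have : 0 ≤ M * ((j / (M : ℝ) ^ 2 - q) - 1 / (2 * M)) ^ 2 := by positivity
    linarith
  refine (ex_mono fun σ => h1 _).trans ?_
  rw [ex_add, ex_const, ex_const_mul, h2, ← ENNReal.ofReal_mul (by positivity),
    ← ENNReal.ofReal_add (mul_nonneg (by positivity) ?_) (by positivity)]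
  · apply ENNReal.ofReal_le_ofReal
    have e : 1 / (2 * M) - ((M : ℝ)⁻¹ ^ 3 * ((-((M ^ 2 : ℕ) * q) + (M ^ 2 : ℕ) * q) ^ 2 +
        (M ^ 2 : ℕ) * (q * (1 - q))) + 1 / (4 * M)) = (M : ℝ)⁻¹ * (q - 1 / 2) ^ 2 := by
      push_cast
      field_simp
      ring
    have : 0 ≤ (M : ℝ)⁻¹ * (q - 1 / 2) ^ 2 := by positivity
    linarith
  · have hq1 : q ≤ 1 := by
      rw [← ENNReal.ofReal_le_one, hq, ofReal_prob]
      exact ex_le_const fun a => ind_le_one _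
    have : 0 ≤ q * (1 - q) := mul_nonneg hq0 (by linarith)
    positivity

/-- A sample is strictly better than `m` independent ones with probability at most `1 / (m+1)`. -/
theorem ex_rank_le {α : Type} (X : PMF α) (v : α → ℕ) (s m : ℕ) (hv : ∀ a, v a ≤ s) :
    (m + 1) * (ex X fun a => (ex X fun b => ind (decide (v b < v a))) ^ m) ≤ 1 := by
  let A : ℕ → ℝ≥0∞ := fun n => ex X fun b => ind (decide (v b < n))
  let p : ℕ → ℝ≥0∞ := fun n => ex X fun b => ind (decide (v b = n))
  have hA (n : ℕ) : A (n + 1) = A n + p n := by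
    simp only [A, p, ← ex_add]
    congr 1; funext b
    rcases lt_trichotomy (v b) n with h | h | h
    · simp [h, h.ne, h.trans (Nat.lt_succ_self n)]
    · simp [h]
    · simp [h.ne', not_lt.2 h.le, show ¬ v b < n + 1 by omega]
  -- The left side consists of two terms of the binomial expansion of the right side.
  have hpow (a p : ℝ≥0∞) : (m + 1) * (p * a ^ m) + a ^ (m + 1) ≤ (a + p) ^ (m + 1) := by
    clear hA
    induction m with
    | zero => simp [add_comm]
    | succ m ih =>
      calc _ = ((m + 1) * (p * a ^ m) + a ^ (m + 1)) * a + a ^ (m + 1) * p := by push_cast; ring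
        _ ≤ (a + p) ^ (m + 1) * a + (a + p) ^ (m + 1) * p := by
          gcongr
          exact le_self_add
        _ = _ := by ring
  -- Telescoping over the possible scores, with `A` the distribution function of the score and `p`
  -- its point masses.
  have hsum (K : ℕ) : (m + 1) * ∑ n ∈ Finset.range K, p n * A n ^ m ≤ A K ^ (m + 1) := by
    induction K with
    | zero => simp
    | succ K ih =>
      rw [Finset.sum_range_succ, mul_add, hA]
      refine le_trans ?_ (hpow _ _)
      rw [add_comm]
      gcongr
  have heq : (ex X fun a => (A (v a)) ^ m) = ∑ n ∈ Finset.range (s + 1), p n * A n ^ m := by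
    simp only [p, ← ex_mul_const]
    rw [← ex_sum]
    congr 1; funext a
    rw [Finset.sum_eq_single (v a)]
    · simp
    · intro n _ hn
      simp [hn.symm]
    · intro h
      exact absurd (Finset.mem_range.2 (Nat.lt_succ_of_le (hv a))) h
  refine (mul_le_mul_right heq.le _).trans ((hsum _).trans ?_)
  exact pow_le_one₀ zero_le (ex_le_const fun a => ind_le_one _)

end CRZK

namespace CRZK
open scoped ENNReal

/-! ### Codes and selection -/

theorem length_padTo (n : ℕ) (l : List Bool) : (padTo n l).length = n := by
  simp [padTo]

/-- Each bit is announced by `true` and the message is closed by `false`, so its end can be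
recognised. -/
theorem codeMsg_inj {m m' s s' : List Bool}
    (h : (m.flatMap fun b => [true, b]) ++ false :: s =
      (m'.flatMap fun b => [true, b]) ++ false :: s') : m = m' ∧ s = s' := by
  induction m generalizing m' with
  | nil =>
    cases m' with
    | nil => simpa using h
    | cons b m' => simp at h
  | cons a m ih =>
    cases m' with
    | nil => simp at h
    | cons b m' =>
      simp only [List.flatMap_cons, List.cons_append, List.nil_append, List.cons.injEq,
        true_and] at h
      obtain ⟨h1, h2⟩ := ih h.2
      exact ⟨by rw [h.1, h1], h2⟩

theorem code_inj {l l' : List (List Bool)} {s s' : List Bool} (hl : l.length = l'.length)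
    (h : code l ++ s = code l' ++ s') : l = l' ∧ s = s' := by
  induction l generalizing l' with
  | nil =>
    obtain rfl : l' = [] := List.length_eq_zero_iff.1 hl.symm
    exact ⟨rfl, h⟩
  | cons m l ih =>
    cases l' with
    | nil => simp at hl
    | cons m' l' =>
      simp only [code, List.flatMap_cons, List.append_assoc, List.cons_append,
        List.nil_append] at h ih
      obtain ⟨h1, h2⟩ := codeMsg_inj h
      obtain ⟨h3, h4⟩ := ih (by simpa using hl) h2
      exact ⟨by rw [h1, h3], h4⟩

/-- Padding bits would decode as empty messages, so decoding is unambiguous only once the number of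
messages is known. -/
theorem padTo_code_inj {n : ℕ} {l l' : List (List Bool)} (hl : l.length = l'.length)
    (h1 : (code l).length ≤ n) (h2 : (code l').length ≤ n)
    (h : padTo n (code l) = padTo n (code l')) : l = l' := by
  rw [padTo, padTo, List.take_append, List.take_append, List.take_of_length_le h1,
    List.take_of_length_le h2] at h
  exact (code_inj hl h).1

theorem foldl_max_spec (score : List Bool → ℕ) (l : List (List Bool)) (s : List Bool) :
    (l.foldl (fun b π => if score b < score π then π else b) s ∈ s :: l) ∧
      ∀ π ∈ s :: l, score π ≤ score (l.foldl (fun b π => if score b < score π then π else b) s) := by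
  induction l generalizing s with
  | nil => simp
  | cons b l ih =>
    obtain ⟨h1, h2⟩ := ih (if score s < score b then b else s)
    rw [List.foldl_cons]
    constructor
    · split_ifs at h1 ⊢ <;> simp only [List.mem_cons] at h1 ⊢ <;> tauto
    · have h3 := h2 _ (List.mem_cons_self ..)
      intro π hπ
      rcases List.mem_cons.1 hπ with rfl | hπ
      · refine le_trans ?_ h3
        split_ifs <;> omega
      rcases List.mem_cons.1 hπ with rfl | hπ
      · refine le_trans ?_ h3
        split_ifs <;> omega
      · exact h2 π (List.mem_cons_of_mem _ hπ)

theorem select_mem (score : List Bool → ℕ) (l : List (List Bool)) :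
    select score l ∈ [] :: l := (foldl_max_spec score l []).1

theorem le_select (score : List Bool → ℕ) {l : List (List Bool)} {π : List Bool} (h : π ∈ l) :
    score π ≤ score (select score l) :=
  (foldl_max_spec score l []).2 π (List.mem_cons_of_mem _ h)

theorem takeD_take {α : Type} {n m : ℕ} (h : n ≤ m) (l : List α) (a : α) :
    (l.take m).takeD n a = l.takeD n a := by
  induction n generalizing m l with
  | zero => rfl
  | succ n ih =>
    obtain ⟨m, rfl⟩ : ∃ j, m = j + 1 := ⟨m - 1, by omega⟩
    cases l with
    | nil => simp
    | cons b l => simp [List.takeD, ih (Nat.le_of_succ_le_succ h)]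

theorem takeD_succ {α : Type} (n : ℕ) (l : List α) (a : α) :
    l.takeD (n + 1) a = l.takeD n a ++ [l.getD n a] := by
  induction n generalizing l with
  | zero => cases l <;> simp [List.takeD]
  | succ n ih =>
    rw [List.takeD, ih]
    cases l <;> simp [List.takeD]

theorem takeD_length {α : Type} (l : List α) (a : α) : l.takeD l.length a = l := by
  rw [List.takeD_eq_take _ le_rfl, List.take_length]

/-! ### Transcripts -/

section transcript

variable (m : ℕ → ℕ) (P : Strategy)

theorem ex_transcript_succ (i : ℕ) (f : List (List Bool) → ℝ≥0∞) :
    ex (transcript m P (i + 1)) f = ex (transcript m P i) fun t => ex (unif (m i)) fun r =>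
      ex (P (t ++ [r])) fun π => f (t ++ [r] ++ [π]) := by
  simp only [transcript, ex_bind, ex_map, List.append_assoc, List.cons_append, List.nil_append]

theorem ex_transcript_le (i : ℕ) {f g : List (List Bool) → ℝ≥0∞}
    (h : ∀ t, t.length = 2 * i → f t ≤ g t) :
    ex (transcript m P i) f ≤ ex (transcript m P i) g := by
  induction i generalizing f g with
  | zero => simp only [transcript, ex_pure]; exact h [] rfl
  | succ i ih =>
    rw [ex_transcript_succ, ex_transcript_succ]
    refine ih fun t ht => ex_mono fun r => ex_mono fun π => ?_
    exact h _ (by simp [ht]; omega)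

theorem ex_transcript_congr (i : ℕ) {f g : List (List Bool) → ℝ≥0∞}
    (h : ∀ t, t.length = 2 * i → f t = g t) :
    ex (transcript m P i) f = ex (transcript m P i) g :=
  le_antisymm (ex_transcript_le m P i fun t ht => (h t ht).le)
    (ex_transcript_le m P i fun t ht => (h t ht).ge)

/-- Later rounds do not influence the distribution of earlier messages. -/
theorem ex_transcript_take {i j : ℕ} (hij : i ≤ j) (f : List (List Bool) → ℝ≥0∞) :
    (ex (transcript m P j) fun t => f (t.take (2 * i))) = ex (transcript m P i) f := by
  induction j, hij using Nat.le_induction with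
  | base =>
    exact ex_transcript_congr m P i fun t ht => by rw [← ht, List.take_length]
  | succ j hij ih =>
    rw [← ih, ex_transcript_succ]
    refine ex_transcript_congr m P j fun t ht => ?_
    have h (r π : List Bool) : (t ++ [r] ++ [π]).take (2 * i) = t.take (2 * i) := by
      rw [List.append_assoc, List.take_append_of_le_length (by omega)]
    simp only [h, ex_const]

end transcript

/-! ### The success probability of the inverting prover -/

namespace Scheme

variable {k : ℕ} (S : Scheme k) (G : Fin k → Gate) (x : List Bool)

/-- The success probability of the inverting prover when `d` rounds are left. -/
noncomputable def val (d : ℕ) (t : List (List Bool)) : ℝ≥0∞ :=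
  ex (unif (S.playCoins G x d)) fun σ => ind (S.play G x d t σ)

theorem val_zero (t : List (List Bool)) : S.val G x 0 t = ind (S.V.accepts x t) := by
  simp only [val, play, ex_const]

theorem val_le_one (d : ℕ) (t : List (List Bool)) : S.val G x d t ≤ 1 :=
  ex_le_const fun _ => ind_le_one _

theorem val_succ (d : ℕ) (t : List (List Bool)) :
    S.val G x (d + 1) t = ex (unif (S.V.coinLen (S.round d) x.length)) fun r =>
      ex (unif (S.moveCoins G x d)) fun μ =>
        S.val G x d (t ++ [r] ++ [S.move G x d (t ++ [r]) μ]) := by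
  rw [val, show S.playCoins G x (d + 1) = S.V.coinLen (S.round d) x.length +
    (S.moveCoins G x d + S.playCoins G x d) from rfl, ex_unif_add]
  refine ex_unif_congr fun r hr => ?_
  rw [ex_unif_add]
  refine ex_unif_congr fun μ hμ => ?_
  rw [val]
  congr 1; funext σ
  rw [play, ← hr, List.take_left, List.drop_left, ← hμ, List.take_left, List.drop_left, move]

theorem ex_move (d : ℕ) (t : List (List Bool)) (f : List Bool → ℝ≥0∞) :
    (ex (unif (S.moveCoins G x d)) fun μ => f (S.move G x d t μ)) =
      ex (unif (S.tries.eval x.length * (G (S.round d)).coins)) fun α =>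
        ex (unif (S.samples.eval x.length * S.playCoins G x d)) fun ω =>
          f (S.pick G x (S.play G x d) d t α ω) := by
  rw [moveCoins, ex_unif_add]
  refine ex_unif_congr fun α hα => ?_
  congr 1; funext ω
  rw [move, pickSplit, ← hα, List.take_left, List.drop_left]

/-- Against the inverting prover the verifier accepts with probability `val k []`. -/
theorem ex_view_move (Q : Strategy)
    (hQ : ∀ d < k, ∀ t : List (List Bool), t.length = 2 * (S.round d : ℕ) + 1 →
      ∀ f : List Bool → ℝ≥0∞,
        ex (Q t) f = ex (unif (S.moveCoins G x d)) fun μ => f (S.move G x d t μ)) :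
    (ex (S.V.view x Q) fun t => ind (S.V.accepts x t)) = S.val G x k [] := by
  -- Unfolds the last `d` rounds of the execution, from the end, into the value function.
  have key (d : ℕ) (hd : d ≤ k) : (ex (S.V.view x Q) fun t => ind (S.V.accepts x t)) =
      ex (transcript (fun i => S.V.coinLen i x.length) Q (k - d)) (S.val G x d) := by
    induction d with
    | zero => rw [Nat.sub_zero, Verifier.view]; congr 1; funext t; rw [val_zero]
    | succ d ih =>
      rw [ih (by omega), show k - d = (k - (d + 1)) + 1 by omega, ex_transcript_succ]
      refine ex_transcript_congr _ _ _ fun t ht => ?_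
      rw [val_succ]
      congr 1; funext r
      exact hQ d (by omega) _ (by simp [ht, round]) _
  rw [key k le_rfl, Nat.sub_self, transcript, ex_pure]

/-! ### The hybrid argument -/

/-- The event that the message of round `k - d - 1` of `t` is estimated to be better than the
inverting prover's message, and separated from it by the threshold `θ`. -/
noncomputable def test (d θ : ℕ) (α ω : List Bool) (t : List (List Bool)) : Bool :=
  decide (θ < S.count G x (S.play G x d) d ω (t.takeD (2 * (S.round d : ℕ) + 2) [])) &&
  !decide (θ < S.count G x (S.play G x d) d ω (t.takeD (2 * (S.round d : ℕ) + 1) [] ++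
    [S.pick G x (S.play G x d) d (t.takeD (2 * (S.round d : ℕ) + 1) []) α ω]))

/-- The estimated advantage over the inverting prover. -/
noncomputable def gap (d : ℕ) (α ω : List Bool) (t : List (List Bool)) : ℕ :=
  S.count G x (S.play G x d) d ω (t.takeD (2 * (S.round d : ℕ) + 2) []) -
  S.count G x (S.play G x d) d ω (t.takeD (2 * (S.round d : ℕ) + 1) [] ++
    [S.pick G x (S.play G x d) d (t.takeD (2 * (S.round d : ℕ) + 1) []) α ω])

theorem count_le (f : List (List Bool) → List Bool → Bool) (d : ℕ) (ω : List Bool)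
    (t : List (List Bool)) : S.count G x f d ω t ≤ S.samples.eval x.length := by
  refine (List.countP_le_length ..).trans ?_
  simp [chunks]

/-- Layer-cake formula: a truncated difference of counts is the number of thresholds separating
them. It turns a number into bits that a distinguisher can output. -/
theorem sum_test (d : ℕ) (α ω : List Bool) (t : List (List Bool)) :
    ∑ θ ∈ Finset.range (S.samples.eval x.length), ind (S.test G x d θ α ω t) =
      (S.gap G x d α ω t : ℝ≥0∞) := by
  have h (s a b : ℕ) (ha : a ≤ s) :
      ∑ θ ∈ Finset.range s, ind (decide (θ < a) && !decide (θ < b)) = ((a - b : ℕ) : ℝ≥0∞) := by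
    have h1 (θ : ℕ) : ind (decide (θ < a) && !decide (θ < b)) =
        if θ ∈ Finset.Ico b a then (1 : ℝ≥0∞) else 0 := by
      by_cases h1 : θ < a <;> by_cases h2 : θ < b <;> simp [h1, h2, not_lt.1, Finset.mem_Ico]
    simp only [h1]
    rw [← Finset.sum_filter, Finset.sum_const, nsmul_one]
    congr 1
    rw [← Nat.card_Ico]
    congr 1
    ext θ
    simp only [Finset.mem_filter, Finset.mem_range, Finset.mem_Ico]
    omega
  exact h _ _ _ (S.count_le ..)

theorem gap_take (d : ℕ) (α ω : List Bool) (t : List (List Bool)) :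
    S.gap G x d α ω (t.take (2 * (S.round d + 1 : ℕ))) = S.gap G x d α ω t := by
  simp only [gap]
  rw [takeD_take (by omega), takeD_take (by omega)]

/-- The estimate for a fixed transcript is unbiased, by linearity. Bias arises only from selecting
the best candidate. -/
theorem ex_count_div (hs : S.samples.eval x.length ≠ 0) (d : ℕ) (t : List (List Bool)) :
    (ex (unif (S.samples.eval x.length * S.playCoins G x d)) fun ω =>
      (S.count G x (S.play G x d) d ω t : ℝ≥0∞) / (S.samples.eval x.length : ℕ)) =
      S.val G x d t := by
  simp only [div_eq_mul_inv, ex_mul_const, count, ex_countP]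
  rw [mul_right_comm, ENNReal.mul_inv_cancel (by exact_mod_cast hs) (by simp), one_mul, val]

end Scheme

end CRZK

namespace CRZK
open scoped ENNReal

theorem le_sum_map_of_mem {α : Type} (f : α → ℝ≥0∞) {l : List α} {a : α} (h : a ∈ l) :
    f a ≤ (l.map f).sum := by
  induction l with
  | nil => simp at h
  | cons b l ih =>
    rw [List.map_cons, List.sum_cons]
    rcases List.mem_cons.1 h with rfl | h
    · exact le_self_add
    · exact (ih h).trans le_add_self

theorem ex_sum_map_le {α β : Type} (X : PMF α) (f : β → α → ℝ≥0∞) (l : List β) (B : ℝ≥0∞)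
    (h : ∀ b ∈ l, ex X (f b) ≤ B) : (ex X fun a => (l.map fun b => f b a).sum) ≤ l.length * B := by
  induction l with
  | nil => simp [ex_const]
  | cons b l ih =>
    simp only [List.map_cons, List.sum_cons, ex_add, List.length_cons, Nat.cast_add, Nat.cast_one,
      add_mul, one_mul]
    rw [add_comm]
    exact add_le_add (ih fun b hb => h b (by simp [hb])) (h b (by simp))

theorem ind_le_prod_map {α : Type} (b : Bool) (g : α → Bool) (l : List α)
    (h : b = true → ∀ a ∈ l, g a = true) : ind b ≤ (l.map fun a => ind (g a)).prod := by
  cases b with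
  | false => simp
  | true =>
    replace h := h rfl
    induction l with
    | nil => simp
    | cons a l ih =>
      rw [List.map_cons, List.prod_cons, h a (by simp), ind_true, one_mul]
      exact ih fun a ha => h a (by simp [ha])

namespace Scheme

variable {k : ℕ} (S : Scheme k) (G : Fin k → Gate) (x : List Bool)

/-- The chosen message depends on the samples, so its estimate is biased upwards. Its excess is at
most the sum of the positive excesses of all candidates, each of which is fixed once the inversion
coins are. -/
theorem ex_pick_le {d : ℕ} {B : ℝ≥0∞}
    (hB : ∀ t, (ex (unif (S.samples.eval x.length * S.playCoins G x d)) fun ω =>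
      (S.count G x (S.play G x d) d ω t : ℝ≥0∞) / (S.samples.eval x.length : ℕ) -
        S.val G x d t) ≤ B) (t : List (List Bool)) :
    (ex (unif (S.tries.eval x.length * (G (S.round d)).coins)) fun α =>
        ex (unif (S.samples.eval x.length * S.playCoins G x d)) fun ω =>
          (S.count G x (S.play G x d) d ω (t ++ [S.pick G x (S.play G x d) d t α ω]) : ℝ≥0∞) /
            (S.samples.eval x.length : ℕ)) ≤
      (ex (unif (S.moveCoins G x d)) fun μ => S.val G x d (t ++ [S.move G x d t μ])) +
        (S.tries.eval x.length + 1 : ℕ) * B := by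
  rw [S.ex_move G x d t fun π => S.val G x d (t ++ [π]), ← ex_const
    (unif (S.tries.eval x.length * (G (S.round d)).coins)) ((S.tries.eval x.length + 1 : ℕ) * B),
    ← ex_add]
  refine ex_mono fun α => ?_
  -- The starting value `[]` of `select` is a candidate too, whence the `+ 1`.
  set l := [] :: (chunks (G (S.round d)).coins (S.tries.eval x.length) α).map
    (S.reply G x (S.round d) t) with hl
  have hlen : l.length = S.tries.eval x.length + 1 := by simp [hl, chunks]
  refine le_trans ?_ (add_le_add_right (hlen ▸ ex_sum_map_le
    (unif (S.samples.eval x.length * S.playCoins G x d)) (fun π ω =>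
      (S.count G x (S.play G x d) d ω (t ++ [π]) : ℝ≥0∞) / (S.samples.eval x.length : ℕ) -
        S.val G x d (t ++ [π])) l B fun π _ => hB _) _)
  rw [← ex_add]
  refine ex_mono fun ω => ?_
  refine le_trans le_add_tsub (add_le_add_right ?_ _)
  exact le_sum_map_of_mem (fun π => (S.count G x (S.play G x d) d ω (t ++ [π]) : ℝ≥0∞) /
    (S.samples.eval x.length : ℕ) - S.val G x d (t ++ [π])) (select_mem _ _)

/-- One step of the hybrid argument for a single prover strategy. -/
theorem ex_transcript_val_le (P : Strategy) {d : ℕ} (hd : d < k) {B : ℝ≥0∞}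
    (hs : S.samples.eval x.length ≠ 0)
    (hB : ∀ t, (ex (unif (S.samples.eval x.length * S.playCoins G x d)) fun ω =>
      (S.count G x (S.play G x d) d ω t : ℝ≥0∞) / (S.samples.eval x.length : ℕ) -
        S.val G x d t) ≤ B) :
    ex (transcript (fun i => S.V.coinLen i x.length) P (k - d)) (S.val G x d) ≤
      ex (transcript (fun i => S.V.coinLen i x.length) P (k - (d + 1))) (S.val G x (d + 1)) +
      (S.tries.eval x.length + 1 : ℕ) * B +
      ex (S.V.view x P) fun t =>
        ex (unif (S.tries.eval x.length * (G (S.round d)).coins)) fun α =>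
          ex (unif (S.samples.eval x.length * S.playCoins G x d)) fun ω =>
            (S.gap G x d α ω t : ℝ≥0∞) / (S.samples.eval x.length : ℕ) := by
  set m := fun i => S.V.coinLen i x.length with hm
  set T := transcript m P (k - (d + 1)) with hT
  have hi : k - d = (S.round d : ℕ) + 1 := by simp only [round]; omega
  -- The gap does not look beyond the current round, so it may be computed on the whole view, which
  -- is what zero knowledge speaks about.
  have h1 := ex_transcript_take m P (show (S.round d : ℕ) + 1 ≤ k by omega) fun t =>
    ex (unif (S.tries.eval x.length * (G (S.round d)).coins)) fun α =>
      ex (unif (S.samples.eval x.length * S.playCoins G x d)) fun ω =>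
        (S.gap G x d α ω t : ℝ≥0∞) / (S.samples.eval x.length : ℕ)
  simp only [gap_take] at h1
  rw [Verifier.view, h1, hi, ex_transcript_succ, ex_transcript_succ,
    ← ex_const T ((S.tries.eval x.length + 1 : ℕ) * B)]
  change ex T _ ≤ ex T _ + ex T _ + ex T _
  rw [← ex_add, ← ex_add]
  -- For each choice of coins, the estimate of the honest message is at most that of the chosen
  -- message plus the gap. Averaging makes the first estimate exact, and `ex_pick_le` controls the
  -- second.
  have h2 (t : List (List Bool)) (ht : t.length = 2 * (S.round d : ℕ)) (r π : List Bool) :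
      S.val G x d (t ++ [r] ++ [π]) ≤
        ((ex (unif (S.moveCoins G x d)) fun μ =>
          S.val G x d (t ++ [r] ++ [S.move G x d (t ++ [r]) μ])) +
        (S.tries.eval x.length + 1 : ℕ) * B) +
        ex (unif (S.tries.eval x.length * (G (S.round d)).coins)) fun α =>
          ex (unif (S.samples.eval x.length * S.playCoins G x d)) fun ω =>
            (S.gap G x d α ω (t ++ [r] ++ [π]) : ℝ≥0∞) / (S.samples.eval x.length : ℕ) := by
    refine le_trans ?_ (add_le_add_left (S.ex_pick_le G x hB _) _)
    rw [← ex_add, ← S.ex_count_div G x hs, ← ex_const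
      (unif (S.tries.eval x.length * (G (S.round d)).coins)) (ex _ _)]
    refine ex_mono fun α => ?_
    rw [← ex_add]
    refine ex_mono fun ω => ?_
    rw [← ENNReal.add_div]
    gcongr
    have e1 : (t ++ [r] ++ [π]).takeD (2 * (S.round d : ℕ) + 2) [] = t ++ [r] ++ [π] := by
      rw [← ht, show t.length + 2 = (t ++ [r] ++ [π]).length by simp, takeD_length]
    have e2 : (t ++ [r] ++ [π]).takeD (2 * (S.round d : ℕ) + 1) [] = t ++ [r] := by
      rw [← takeD_take (m := (t ++ [r]).length) (by simp [ht]), List.take_left, ← ht,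
        show t.length + 1 = (t ++ [r]).length by simp, takeD_length]
    rw [gap, e1, e2]
    norm_cast
    omega
  refine ex_transcript_le m P _ fun t ht => ?_
  rw [val_succ, ← ex_const (unif (m (S.round d))) ((S.tries.eval x.length + 1 : ℕ) * B)]
  change ex (unif (m (S.round d))) _ ≤ ex (unif (m (S.round d))) _ +
    ex (unif (m (S.round d))) _ + ex (unif (m (S.round d))) _
  rw [← ex_add, ← ex_add]
  refine ex_mono fun r => ?_
  refine (ex_mono fun π => h2 t ht r π).trans_eq ?_
  rw [ex_add, ex_const]

/-- One step of the hybrid argument. -/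
theorem hybrid_step {γ : Type} (X : PMF γ) (P : γ → Strategy) (T : PMF (List (List Bool)))
    {d : ℕ} (hd : d < k) {B ε δ : ℝ≥0∞} (hs : S.samples.eval x.length ≠ 0)
    (hB : ∀ t, (ex (unif (S.samples.eval x.length * S.playCoins G x d)) fun ω =>
      (S.count G x (S.play G x d) d ω t : ℝ≥0∞) / (S.samples.eval x.length : ℕ) -
        S.val G x d t) ≤ B)
    (hε : ∀ θ < S.samples.eval x.length, ∀ α ω : List Bool,
      α.length = S.tries.eval x.length * (G (S.round d)).coins →
      ω.length = S.samples.eval x.length * S.playCoins G x d →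
      (ex (X.bind fun g => S.V.view x (P g)) fun t => ind (S.test G x d θ α ω t)) ≤
        (ex T fun t => ind (S.test G x d θ α ω t)) + ε)
    (hδ : ∀ ω, (ex T fun t => ex (unif (S.tries.eval x.length * (G (S.round d)).coins)) fun α =>
      (S.gap G x d α ω t : ℝ≥0∞) / (S.samples.eval x.length : ℕ)) ≤ δ) :
    (ex X fun g => ex (transcript (fun i => S.V.coinLen i x.length) (P g) (k - d))
      (S.val G x d)) ≤
    (ex X fun g => ex (transcript (fun i => S.V.coinLen i x.length) (P g) (k - (d + 1)))
      (S.val G x (d + 1))) + ((S.tries.eval x.length + 1 : ℕ) * B + (δ + ε)) := by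
  refine (ex_mono fun g => S.ex_transcript_val_le G x (P g) hd hs hB).trans ?_
  rw [ex_add, ex_add, ex_const, add_assoc]
  gcongr
  rw [← ex_bind X (fun g => S.V.view x (P g)), ex_comm]
  -- The coins are fixed before the transcript distribution is switched, because they become advice
  -- of the distinguisher; afterwards they are averaged again.
  calc _ ≤ ex (unif (S.tries.eval x.length * (G (S.round d)).coins)) fun α =>
          ex (unif (S.samples.eval x.length * S.playCoins G x d)) fun ω =>
            (ex T fun t => (S.gap G x d α ω t : ℝ≥0∞) / (S.samples.eval x.length : ℕ)) + ε := by
        refine ex_unif_le fun α hα => ?_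
        rw [ex_comm]
        refine ex_unif_le fun ω hω => ?_
        -- The number of thresholds equals the number of samples, so the normalised gap is an
        -- average of tests and `ε` is paid only once.
        have h1 (W : PMF (List (List Bool))) :
            (ex W fun t => (S.gap G x d α ω t : ℝ≥0∞) / (S.samples.eval x.length : ℕ)) =
            (∑ θ ∈ Finset.range (S.samples.eval x.length),
              ex W fun t => ind (S.test G x d θ α ω t)) / (S.samples.eval x.length : ℕ) := by
          simp only [div_eq_mul_inv, ex_mul_const, ← sum_test, ex_sum]
        rw [h1, h1]
        refine (ENNReal.div_le_div_right (Finset.sum_le_sum fun θ hθ =>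
          hε θ (Finset.mem_range.1 hθ) α ω hα hω) _).trans ?_
        rw [Finset.sum_add_distrib, Finset.sum_const, Finset.card_range, nsmul_eq_mul,
          ENNReal.add_div, mul_comm, mul_div_assoc, ENNReal.div_self (by exact_mod_cast hs)
            (by simp), mul_one]
    _ = (ex (unif (S.samples.eval x.length * S.playCoins G x d)) fun ω =>
          ex T fun t => ex (unif (S.tries.eval x.length * (G (S.round d)).coins)) fun α =>
            (S.gap G x d α ω t : ℝ≥0∞) / (S.samples.eval x.length : ℕ)) + ε := by
        simp only [ex_add, ex_const]
        congr 1
        rw [ex_comm]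
        congr 1; funext ω
        rw [ex_comm]
    _ ≤ _ := by
        gcongr
        exact ex_le_const hδ

/-! ### The loss on simulated transcripts -/

/-- The probability that one inversion attempt scores less than `b`. -/
noncomputable def loseProb (d : ℕ) (ω : List Bool) (t : List (List Bool)) (b : ℕ) : ℝ≥0∞ :=
  ex (unif (G (S.round d)).coins) fun α => ind (decide
    (S.count G x (S.play G x d) d ω (t ++ [S.reply G x (S.round d) t α]) < b))

/-- A positive gap forces every attempt to score strictly below the message in `t`, and the attempts
use independent coins. The normalised gap is at most 1, so it is dominated by the indicator of this
event. -/
theorem ex_gap_le (d : ℕ) (ω : List Bool) (t : List (List Bool)) :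
    (ex (unif (S.tries.eval x.length * (G (S.round d)).coins)) fun α =>
      (S.gap G x d α ω t : ℝ≥0∞) / (S.samples.eval x.length : ℕ)) ≤
    S.loseProb G x d ω (t.takeD (2 * (S.round d : ℕ) + 1) [])
      (S.count G x (S.play G x d) d ω (t.takeD (2 * (S.round d : ℕ) + 2) [])) ^
        S.tries.eval x.length := by
  rw [loseProb, ← ex_chunks_prod]
  refine ex_mono fun α => ?_
  set b := S.count G x (S.play G x d) d ω (t.takeD (2 * (S.round d : ℕ) + 2) []) with hb
  refine le_trans ?_ (ind_le_prod_map (decide (S.gap G x d α ω t ≠ 0)) _ _ fun h a ha => ?_)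
  · by_cases h : S.gap G x d α ω t = 0
    · simp [h]
    · rw [show decide (S.gap G x d α ω t ≠ 0) = true by simpa using h, ind_true]
      refine ENNReal.div_le_of_le_mul ?_
      rw [one_mul]
      exact_mod_cast (Nat.sub_le _ _).trans (S.count_le ..)
  · have h1 := le_select (fun π => S.count G x (S.play G x d) d ω
      (t.takeD (2 * (S.round d : ℕ) + 1) [] ++ [π]))
      (List.mem_map_of_mem (f := S.reply G x (S.round d) (t.takeD (2 * (S.round d : ℕ) + 1) [])) ha)
    have h2 : S.gap G x d α ω t ≠ 0 := by simpa using h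
    rw [gap, ← hb, pick] at h2
    simp only [decide_eq_true_eq]
    omega

/-- The gate `i` inverts `image i` distributionally, in terms of expectations. -/
def Inverts (i : Fin k) (δ : ℝ≥0∞) : Prop :=
  ∀ Φ : List Bool → List Bool → ℝ≥0∞, (∀ u y, Φ u y ≤ 1) →
    ((ex (unif (S.seedLen G x i)) fun u => Φ u (S.image x i u)) ≤
      (ex (unif (S.seedLen G x i)) fun u => ex (unif (G i).coins) fun α =>
        Φ ((G i).answer (.cons (.ofBits x) (.ofBits (S.image x i u))) α) (S.image x i u)) + δ) ∧
    ((ex (unif (S.seedLen G x i)) fun u => ex (unif (G i).coins) fun α =>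
        Φ ((G i).answer (.cons (.ofBits x) (.ofBits (S.image x i u))) α) (S.image x i u)) ≤
      (ex (unif (S.seedLen G x i)) fun u => Φ u (S.image x i u)) + δ)

/-- The output length of the function families suffices for the codes of simulated transcripts. -/
def Wide : Prop :=
  ∀ (i : Fin k) (b : Bool) (x u : List Bool), x.length ≤ u.length →
    (code ([b] :: (S.simMsgs x u).takeD (2 * i + 1) [])).length ≤ S.width.eval u.length

theorem length_le_seedLen (i : Fin k) : x.length ≤ S.seedLen G x i := by
  simp only [seedLen, domLen, Polynomial.eval_add, Polynomial.eval_X]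
  omega

variable {S G x} in
-- The code is self-delimiting, and by `Wide` nothing of it is cut off.
theorem image_inj (hW : S.Wide) {i : Fin k} {u u' : List Bool} (h1 : x.length ≤ u.length)
    (h2 : u'.length = u.length) (h : S.image x i u = S.image x i u') :
    S.flag x i u = S.flag x i u' ∧
      (S.simMsgs x u).takeD (2 * i + 1) [] = (S.simMsgs x u').takeD (2 * i + 1) [] := by
  rw [image, image, h2] at h
  have := padTo_code_inj (by simp) (hW i _ x u h1) (h2 ▸ hW i _ x u' (h2 ▸ h1)) h
  simpa using this

/-- Links the two sides of the construction: on a simulated prefix with flag 1, the prover inverts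
exactly at the image of the simulator's seed. -/
theorem image_eq_target {i : Fin k} {u : List Bool} (hu : u.length = S.seedLen G x i)
    (h : S.flag x i u = true) :
    S.image x i u = S.target G x i ((S.simMsgs x u).takeD (2 * i + 1) []) := by
  rw [image, target, h, hu]

/-- In all rounds but the last, many inversion attempts are at least as good as the simulator. -/
theorem ex_loseProb_le (hW : S.Wide) {d : ℕ} (hd : (S.round d : ℕ) + 1 < k) {δ : ℝ≥0∞}
    (hI : S.Inverts G x (S.round d) δ) (ω : List Bool) :
    (ex (unif (S.seedLen G x (S.round d))) fun u =>
      S.loseProb G x d ω ((S.simMsgs x u).takeD (2 * (S.round d : ℕ) + 1) [])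
        (S.count G x (S.play G x d) d ω ((S.simMsgs x u).takeD (2 * (S.round d : ℕ) + 2) [])) ^
          S.tries.eval x.length) ≤ ((S.tries.eval x.length + 1 : ℕ) : ℝ≥0∞)⁻¹ + δ := by
  classical
  set i := S.round d with hi
  have hflag (u : List Bool) : S.flag x i u = true := by simp [flag, hd]
  -- The test function in `Inverts` sees only a preimage and an image, so the prefix has to be
  -- recovered from the image. By `image_inj` the chosen preimage does not matter.
  let D : List Bool → List (List Bool) := fun y =>
    if h : ∃ u, u.length = S.seedLen G x i ∧ S.image x i u = y then
      (S.simMsgs x h.choose).takeD (2 * i + 1) [] else []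
  have hD (u : List Bool) (hu : u.length = S.seedLen G x i) :
      D (S.image x i u) = (S.simMsgs x u).takeD (2 * i + 1) [] := by
    have h : ∃ u', u'.length = S.seedLen G x i ∧ S.image x i u' = S.image x i u := ⟨u, hu, rfl⟩
    simp only [D, dif_pos h]
    refine (image_inj hW ?_ ?_ h.choose_spec.2).2
    · rw [h.choose_spec.1]; exact S.length_le_seedLen G x i
    · rw [h.choose_spec.1, hu]
  let msg : List Bool → List Bool := fun u => (S.simMsgs x u).getD (2 * i + 1) []
  let v : List Bool → List Bool → ℕ := fun y u =>
    S.count G x (S.play G x d) d ω (D y ++ [msg u])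
  let ans : List Bool → List Bool → List Bool := fun y α =>
    (G i).answer (.cons (.ofBits x) (.ofBits y)) α
  -- Replaces the simulator's seed by an answer of the inverter, at the cost of `δ`.
  have h1 := (hI (fun u y => (ex (unif (G i).coins) fun α => ind (decide
    (v y (ans y α) < v y u))) ^ S.tries.eval x.length)
    fun u y => pow_le_one₀ zero_le (ex_le_const fun α => ind_le_one _)).1
  refine le_trans (ex_unif_le fun u hu => ?_) (h1.trans (add_le_add_left (ex_le_const fun u => ?_) _))
  · simp only [v, hD u hu, loseProb, ans, msg, ← takeD_succ]
    rw [S.image_eq_target G x hu (hflag u)]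
    rfl
  -- For a fixed image, the replaced seed and the attempts are now independent and identically
  -- distributed, valid preimages or not.
  · rw [ENNReal.le_inv_iff_mul_le, mul_comm, Nat.cast_add, Nat.cast_one]
    exact ex_rank_le (unif (G i).coins) (fun α => v (S.image x i u) (ans (S.image x i u) α)) _ _
      fun α => S.count_le ..

/-- In the last round, inversion attempts make the verifier accept. -/
theorem ex_loseProb_last_le (hW : S.Wide) {δ : ℝ≥0∞} (hI : S.Inverts G x (S.round 0) δ)
    (hm : S.tries.eval x.length ≠ 0) (ω : List Bool) :
    (ex (unif (S.seedLen G x (S.round 0))) fun u =>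
      S.loseProb G x 0 ω ((S.simMsgs x u).takeD (2 * (S.round 0 : ℕ) + 1) [])
        (S.count G x (S.play G x 0) 0 ω ((S.simMsgs x u).takeD (2 * (S.round 0 : ℕ) + 2) [])) ^
          S.tries.eval x.length) ≤ δ := by
  classical
  set i := S.round 0 with hi
  have hik : (i : ℕ) + 1 = k := by have := S.pos; simp only [hi, round]; omega
  have hflag (u : List Bool) :
      S.flag x i u = S.V.accepts x ((S.simMsgs x u).takeD (2 * i + 2) []) := by
    rw [flag, if_neg (by simp; omega), show 2 * k = 2 * (i : ℕ) + 2 by omega]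
  let ans : List Bool → List Bool → List Bool := fun y α =>
    (G i).answer (.cons (.ofBits x) (.ofBits y)) α
  -- Tests whether an answer fails to be a preimage of the right length. The true seed never fails,
  -- so the inverter fails with probability at most `δ`.
  have h1 := (hI (fun u y => ind (!decide (S.image x i u = y ∧ u.length = S.seedLen G x i)))
    fun u y => ind_le_one _).2
  have h2 : (ex (unif (S.seedLen G x i)) fun u => ind (!decide (S.image x i u = S.image x i u ∧
      u.length = S.seedLen G x i))) = 0 := by
    rw [← ex_const (unif (S.seedLen G x i)) 0]
    exact ex_unif_congr fun u hu => by simp [hu]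
  rw [h2, zero_add] at h1
  refine le_trans (ex_unif_le fun u hu => ?_) h1
  -- A single attempt is enough in this round.
  refine (pow_le_of_le_one zero_le (ex_le_const fun α => ind_le_one _) hm).trans ?_
  refine ex_mono fun α => ?_
  set t := (S.simMsgs x u).takeD (2 * i + 1) [] with ht
  have hcount (t : List (List Bool)) : S.count G x (S.play G x 0) 0 ω t =
      if S.V.accepts x t then S.samples.eval x.length else 0 := by
    simp only [count, play]
    cases S.V.accepts x t <;> simp [List.countP_true, chunks, List.countP_false]
  by_cases hacc : S.V.accepts x ((S.simMsgs x u).takeD (2 * i + 2) []) = true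
  · rw [hcount ((S.simMsgs x u).takeD (2 * i + 2) []), if_pos hacc]
    have htar := S.image_eq_target G x hu ((hflag u).trans hacc)
    rw [htar, ← ht]
    by_cases h : S.image x i (ans (S.target G x i t) α) = S.target G x i t ∧
        (ans (S.target G x i t) α).length = S.seedLen G x i
    -- A genuine preimage has the same prefix and the same acceptance bit, so its message makes the
    -- verifier accept and cannot score less.
    · have h3 := image_inj hW (x := x) (u := u) (S.length_le_seedLen G x i |>.trans hu.ge)
        (h.2.trans hu.symm) (htar.trans h.1.symm)
      rw [hflag, hflag, hacc, takeD_succ _ (S.simMsgs x (ans _ α)), ← h3.2, ← ht] at h3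
      have h4 : S.reply G x i t α =
        (S.simMsgs x (ans (S.target G x i t) α)).getD (2 * i + 1) [] := rfl
      rw [h4, hcount, ← h3.1]
      simp
    · rw [show decide (_ ∧ _) = false from decide_eq_false h]
      simpa using ind_le_one _
  · rw [hcount ((S.simMsgs x u).takeD (2 * i + 2) []), if_neg hacc]
    simp

end Scheme

end CRZK

/-! ### Reduction, function families, distinguishers and provers as programs -/

namespace CRZK
open Enc
open scoped ENNReal

theorem totalCoins_noOracle (O : Empty → Gate) : totalCoins O = 0 := by simp [totalCoins]

theorem size_bits_le (l : List Bool) : (enc l).size ≤ 4 * l.length + 1 := by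
  rw [enc_bits]; exact Data.size_ofBits_le l

theorem FP.exists_prog {ι β : Type} [Fintype ι] [Enc β] {f : (ι → Gate) → Data → β} (hf : FP f) :
    ∃ p : Prog ι, p.PolyTime ∧ ∀ O a, p.eval O a = enc (f O a) := by
  obtain ⟨p, T, h⟩ := hf
  refine ⟨p, ⟨T, fun O a => ?_⟩, fun O a => ?_⟩
  · obtain ⟨t, h1, h2⟩ := h O a
    exact ⟨_, t, h1, h2⟩
  · obtain ⟨t, h1, h2⟩ := h O a
    exact h1.eval_eq

/-- Polynomial-time computable numbers are bounded by a polynomial in the length of the instance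
and the number of coins of the gates. -/
theorem FP.exists_poly {ι : Type} [Fintype ι] {f : (ι → Gate) → List Bool → ℕ} (hf : FP f) :
    ∃ C : Polynomial ℕ, ∀ O x, f O x ≤ C.eval (x.length + totalCoins O) := by
  obtain ⟨T, hT⟩ := hf.size_bound
  refine ⟨T.comp (4 * .X + 1), fun O x => ?_⟩
  have h1 := hT O x
  rw [size_enc_nat] at h1
  have h2 := size_bits_le x
  have h3 := eval_mono T (show (enc x).size + totalCoins O ≤ 4 * (x.length + totalCoins O) + 1 by
    omega)
  simp only [Polynomial.eval_comp, Polynomial.eval_add, Polynomial.eval_mul, Polynomial.eval_X,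
    Polynomial.eval_one, Polynomial.eval_ofNat]
  dsimp only at h3
  omega

theorem FP.gates_self (k : ℕ) : FP.Gates fun (O : Fin k → Gate) (_ : List Bool) => O where
  coins := FP.gateCoins
  answer j := FP.gateQuery j FP.id.snd.fst FP.id.snd.snd.fst FP.id.snd.snd.snd

theorem FP.gates_ppt {k : ℕ} (A : Fin k → PPT) :
    FP.Gates fun (_ : Empty → Gate) (x : List Bool) j => (A j).gate x.length where
  coins _ := FP.polyEval (FP.add FP.id.length (FP.const _)) _
  answer j := FP.take FP.id.snd.fst (FP.toBits (FP.runPPT (A j) FP.id.snd.snd.fst FP.id.snd.snd.snd))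

/-! ### Uniformity in the advice -/

/-- The definition fixes the advice sequence before the threshold `N`. Collecting one bad advice
string for each length that has one gives a single sequence, and its threshold then works for all
advice of the given length. -/
theorem ZeroKnowledge.exists_sim {rel : List Bool → List Bool → Prop}
    {view : List Bool → List Bool → PMF (List (List Bool))} {ε : ℕ → ℝ}
    (h : ZeroKnowledge rel view ε) :
    ∃ Sim : PPT, ∀ (D : PPT) (b : Polynomial ℕ), ∃ N : ℕ, ∀ x w z : List Bool, N ≤ x.length →
      rel x w → z.length ≤ b.eval x.length →
      |distProb D x z ((Sim.sample noOracle x.length (.ofBits x)).map Data.toMsgs) -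
        distProb D x z (view x w)| ≤ ε x.length := by
  classical
  obtain ⟨Sim, h⟩ := h
  refine ⟨Sim, fun D b => ?_⟩
  let bad : ℕ → List Bool → Prop := fun n z => z.length ≤ b.eval n ∧ ∃ x w, x.length = n ∧
    rel x w ∧ ¬ |distProb D x z ((Sim.sample noOracle x.length (.ofBits x)).map Data.toMsgs) -
        distProb D x z (view x w)| ≤ ε x.length
  let z : ℕ → List Bool := fun n => if h : ∃ z, bad n z then h.choose else []
  obtain ⟨N, hN⟩ := h D z ⟨b, fun n => by
    by_cases h : ∃ z, bad n z
    · simp only [z, dif_pos h]; exact h.choose_spec.1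
    · simp [z, dif_neg h]⟩
  refine ⟨N, fun x w z' hx hw hz' => ?_⟩
  by_contra hcon
  have hbad : ∃ z, bad x.length z := ⟨z', hz', x, w, rfl, hw, hcon⟩
  obtain ⟨-, x', w', hx', hw', hcon'⟩ := hbad.choose_spec
  have := hN x' w' (by omega) hw'
  simp only [z, hx', dif_pos hbad] at this hcon'
  exact hcon' this

/-- The distinguisher tosses no coins; all randomness of the tests will sit in the advice. -/
theorem FP.exists_distinguisher
    {h : (Empty → Gate) → List Bool × List Bool × List (List Bool) → Bool} (hh : FP h) :
    ∃ D : PPT, ∀ x z X, ENNReal.ofReal (distProb D x z X) =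
      ex X fun t => ind (h noOracle (x, z, t)) := by
  obtain ⟨p, hp, hpe⟩ := FP.exists_prog (hh.comp (FP.pair (FP.toBits (FP.id (α := Data)).dataFst.dataFst)
    (FP.pair (FP.toBits FP.id.dataFst.dataSnd.dataFst) (FP.toMsgs FP.id.dataFst.dataSnd.dataSnd))))
  refine ⟨⟨p, hp, 0⟩, fun x z X => ?_⟩
  rw [distProb, ofReal_prob, ex_bind]
  congr 1; funext t
  rw [RandAlg.sample, ex_map, RandAlg.numCoins, Polynomial.eval_zero, ex_unif_zero, RandAlg.run,
    hpe, truthy_enc_bool]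
  simp only [Data.fst, Data.snd, Data.toBits_ofBits, Data.toMsgs_ofMsgs]

namespace Scheme

variable {k : ℕ} (S : Scheme k)

theorem exists_wide (S : Scheme k) : ∃ W : Polynomial ℕ, Wide { S with width := W } := by
  have h1 (i : Fin k) : FP fun (_ : Empty → Gate) (a : List Bool × List Bool × Bool) =>
      code ([a.2.2] :: (S.simMsgs a.1 a.2.1).takeD (2 * i + 1) []) :=
    FP.code (FP.cons (FP.cons FP.id.snd.snd FP.nil)
      (FP.takeD (FP.simMsgs S FP.id.fst FP.id.snd.fst) _))
  choose T hT using fun i => (h1 i).size_bound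
  -- Both strings have length at most `u.length` and so encode in `4 * u.length + 1` nodes each; the
  -- bit takes at most 3, and the two pairings add 2.
  refine ⟨∑ i, (T i).comp (8 * .X + 7), fun i b x u hxu => ?_⟩
  have h2 := (length_le_size _).trans (hT i noOracle (x, u, b))
  refine h2.trans ?_
  simp only [Polynomial.eval_finsetSum, Polynomial.eval_comp, Polynomial.eval_add,
    Polynomial.eval_mul, Polynomial.eval_X, Polynomial.eval_ofNat]
  refine le_trans (eval_mono (T i) ?_) (Finset.single_le_sum
    (f := fun i => (T i).eval (8 * u.length + 7)) (fun _ _ => Nat.zero_le _) (Finset.mem_univ i))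
  have := size_bits_le x
  have := size_bits_le u
  have := size_enc_bool_le b
  rw [totalCoins_noOracle]
  simp only [enc_pair, Data.size]
  omega

/-- The oracles enter only through the input length, which `domLen` makes long enough for the
simulator's coins and at least the length of the instance. -/
theorem exists_family {ι : Type} [Fintype ι] (i : ℕ) : ∃ F : FunFamily ι, F.inLen = S.domLen ∧
    ∀ O x u, F.fn O x u = S.image x i u := by
  obtain ⟨p, hp, hpe⟩ := FP.exists_prog (ι := ι) (FP.image S i (FP.toBits FP.id.dataFst)
    (FP.toBits FP.id.dataSnd))
  have h (O : ι → Gate) (x u : List Bool) :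
      (p.eval O (.cons (.ofBits x) (.ofBits u))).toBits = S.image x i u := by
    rw [hpe, enc_bits, Data.toBits_ofBits]
    simp only [Data.fst, Data.snd, Data.toBits_ofBits]
  refine ⟨⟨p, hp, S.domLen, S.width.comp S.domLen, fun O x u hu => ?_⟩, rfl, h⟩
  rw [h, image, length_padTo, hu, Polynomial.eval_comp]

theorem exists_reduction : ∃ R : RandAlg (Fin k), ∀ (G : Fin k → Gate) (x : List Bool),
    ENNReal.ofReal (prob (R.sample G x.length (.ofBits x)) Data.truthy) = S.val G x k [] := by
  obtain ⟨C, hC⟩ := FP.exists_poly (FP.playCoins S (FP.gates_self k) k FP.id)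
  have hx : FP fun (_ : Fin k → Gate) (a : Data) => a.fst.toBits := FP.toBits FP.id.dataFst
  have h1 := (FP.play S (FP.gates_self k) k).comp (hx.pair (FP.nil.pair
    (FP.take (FP.playCoins S (FP.gates_self k) k hx) (FP.toBits FP.id.dataSnd))))
  obtain ⟨p, hp, hpe⟩ := FP.exists_prog h1
  refine ⟨⟨p, hp, C⟩, fun G x => ?_⟩
  rw [ofReal_prob, RandAlg.sample, ex_map, val, ← ex_unif_take (hC G x)]
  simp only [RandAlg.run, hpe, truthy_enc_bool, Data.fst, Data.snd, Data.toBits_ofBits]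
  rfl

variable (A : Fin k → PPT)

/-- The inverters as oracle gates. -/
noncomputable abbrev gates (x : List Bool) : Fin k → Gate := fun j => (A j).gate x.length

/-- The advice is `α`, `ω` and the threshold in unary, concatenated. The lengths of `α` and `ω` are
computable from the instance, so it can be split again. One distinguisher thus serves all coins and
thresholds. -/
theorem exists_test (d : ℕ) : ∃ (D : PPT) (b : Polynomial ℕ), ∀ (x : List Bool) (θ : ℕ)
    (α ω : List Bool), θ < S.samples.eval x.length →
    α.length = S.tries.eval x.length * (gates A x (S.round d)).coins →
    ω.length = S.samples.eval x.length * S.playCoins (gates A x) x d →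
    ∃ z : List Bool, z.length ≤ b.eval x.length ∧ ∀ X, ENNReal.ofReal (distProb D x z X) =
      ex X fun t => ind (S.test (gates A x) x d θ α ω t) := by
  have hG := FP.gates_ppt A
  have hx : FP fun (_ : Empty → Gate) (a : List Bool × List Bool × List (List Bool)) => a.1 := FP.id.fst
  have hz : FP fun (_ : Empty → Gate) (a : List Bool × List Bool × List (List Bool)) => a.2.1 :=
    FP.id.snd.fst
  have ht : FP fun (_ : Empty → Gate) (a : List Bool × List Bool × List (List Bool)) => a.2.2 :=
    FP.id.snd.snd
  have hα := FP.mul (FP.polyEval hx.length S.tries) ((hG.coins (S.round d)).comp hx)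
  have hω := FP.mul (FP.polyEval hx.length S.samples) (FP.playCoins S hG d hx)
  have hf := FP.play S hG d
  have ht1 := FP.takeD ht (2 * (S.round d : ℕ) + 1)
  have hc1 := FP.count S hG (f := fun O x => S.play (gates A x) x d) hf d hx
    (FP.takeD ht (2 * (S.round d : ℕ) + 2)) (FP.take hω (FP.drop hα hz))
  have hc2 := FP.count S hG (f := fun O x => S.play (gates A x) x d) hf d hx
    (FP.append ht1 (FP.cons (FP.pick S hG (f := fun O x => S.play (gates A x) x d) hf d hx ht1
      (FP.take hα hz) (FP.take hω (FP.drop hα hz))) FP.nil)) (FP.take hω (FP.drop hα hz))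
  have hθ := FP.length (FP.drop hω (FP.drop hα hz))
  obtain ⟨D, hD⟩ := FP.exists_distinguisher (FP.and (FP.lt hθ hc1) (FP.not (FP.lt hθ hc2)))
  obtain ⟨b, hb⟩ := FP.exists_poly (ι := Empty) (FP.add (FP.add
    (FP.mul (FP.polyEval FP.id.length S.tries) (hG.coins (S.round d)))
    (FP.mul (FP.polyEval FP.id.length S.samples) (FP.playCoins S hG d FP.id)))
    (FP.polyEval FP.id.length S.samples))
  refine ⟨D, b, fun x θ α ω hθ hα hω => ⟨α ++ (ω ++ List.replicate θ true), ?_, fun X => ?_⟩⟩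
  · have h1 := hb noOracle x
    rw [totalCoins_noOracle, add_zero] at h1
    simp only [List.length_append, List.length_replicate]
    rw [← add_assoc]
    exact (add_le_add (add_le_add hα.le hω.le) hθ.le).trans h1
  · rw [hD]
    simp only [← hα, ← hω, List.take_left, List.drop_left, List.length_replicate]
    rfl

/-- The moves need no memory: the number of messages so far determines the round, and fresh coins
are used in each. -/
theorem exists_prover : ∃ P : PPT, ∀ x, ∀ d < k, ∀ t : List (List Bool),
    t.length = 2 * (S.round d : ℕ) + 1 → ∀ f : List Bool → ℝ≥0∞,
      ex ((P.sample noOracle x.length (.cons (.ofBits x) (.ofMsgs t))).map Data.toBits) f =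
      ex (unif (S.moveCoins (gates A x) x d)) fun μ => f (S.move (gates A x) x d t μ) := by
  have hG := FP.gates_ppt A
  let g : ℕ → List Bool → List (List Bool) → List Bool → List Bool := fun j x t ρ =>
    Nat.rec [] (fun d r => if decide (2 * (S.round d : ℕ) < t.length) &&
      decide (t.length < 2 * (S.round d : ℕ) + 2) then
        S.move (gates A x) x d t (ρ.take (S.moveCoins (gates A x) x d)) else r) j
  have hx : FP fun (_ : Empty → Gate) (a : Data) => a.fst.fst.toBits := FP.toBits FP.id.dataFst.dataFst
  have ht : FP fun (_ : Empty → Gate) (a : Data) => a.fst.snd.toMsgs := FP.toMsgs FP.id.dataFst.dataSnd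
  have hρ : FP fun (_ : Empty → Gate) (a : Data) => a.snd.toBits := FP.toBits FP.id.dataSnd
  have hg (j : ℕ) : FP fun (_ : Empty → Gate) (a : Data) =>
      g j a.fst.fst.toBits a.fst.snd.toMsgs a.snd.toBits := by
    induction j with
    | zero => exact FP.nil
    | succ j ih =>
      exact FP.ite (FP.and (FP.lt (FP.const _) ht.length) (FP.lt ht.length (FP.const _)))
        (FP.move S hG j hx ht (FP.take (FP.moveCoins S hG j hx) hρ)) ih
  have hgv (x : List Bool) (t : List (List Bool)) (ρ : List Bool) (d j : ℕ) (hdj : d < j)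
      (hj : j ≤ k) (htd : t.length = 2 * (S.round d : ℕ) + 1) :
      g j x t ρ = S.move (gates A x) x d t (ρ.take (S.moveCoins (gates A x) x d)) := by
    induction j with
    | zero => omega
    | succ j ih =>
      rcases Nat.lt_succ_iff_lt_or_eq.1 hdj with h | rfl
      · have h1 : (S.round d : ℕ) = k - (d + 1) := rfl
        have h2 : (S.round j : ℕ) = k - (j + 1) := rfl
        refine Eq.trans (if_neg ?_) (ih h (by omega))
        rw [Bool.and_eq_true, decide_eq_true_eq, decide_eq_true_eq]
        omega
      · refine if_pos ?_
        simp only [Bool.and_eq_true, decide_eq_true_eq]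
        omega
  choose C hC using fun d => FP.exists_poly (ι := Empty) (FP.moveCoins S hG d FP.id)
  obtain ⟨p, hp, hpe⟩ := FP.exists_prog (hg k)
  refine ⟨⟨p, hp, ∑ d ∈ Finset.range k, C d⟩, fun x d hd t htd f => ?_⟩
  have hle : S.moveCoins (gates A x) x d ≤
      (∑ d ∈ Finset.range k, C d).eval (x.length + totalCoins noOracle) := by
    rw [Polynomial.eval_finsetSum]
    exact (hC d noOracle x).trans (Finset.single_le_sum
      (f := fun d => (C d).eval (x.length + totalCoins noOracle)) (fun _ _ => Nat.zero_le _)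
      (Finset.mem_range.2 hd))
  rw [ex_map, RandAlg.sample, ex_map, ← ex_unif_take hle]
  simp only [RandAlg.run, hpe, enc_bits, Data.fst, Data.snd, Data.toBits_ofBits,
    Data.toMsgs_ofMsgs]
  congr 1; funext ρ
  rw [hgv x t ρ d k hd le_rfl htd]

theorem sound_of_statSound {L : Language Bool} {ε : ℕ → ℝ} (h : StatSound S.V L ε) (x : List Bool)
    (hx : x ∉ L) (G : Fin k → Gate) : S.val G x k [] ≤ ENNReal.ofReal (ε x.length) := by
  -- The number of rounds left is read off the transcript length, which is `2i + 1` in round `i`.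
  rw [← S.ex_view_move G x (fun t => (unif (S.moveCoins G x (k - 1 - t.length / 2))).map
    (S.move G x (k - 1 - t.length / 2) t)), ← ofReal_prob]
  · exact ENNReal.ofReal_le_ofReal (h x hx _)
  · intro d hd t ht f
    rw [show k - 1 - t.length / 2 = d by rw [ht]; simp only [round]; omega, ex_map]

theorem sound_of_compSound {L : Language Bool} {ε : ℕ → ℝ} (h : CompSound S.V L ε) :
    ∃ N, ∀ x : List Bool, N ≤ x.length → x ∉ L →
      S.val (gates A x) x k [] ≤ ENNReal.ofReal (ε x.length) := by
  obtain ⟨P, hP⟩ := S.exists_prover A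
  obtain ⟨N, hN⟩ := h P
  refine ⟨N, fun x hx hxL => ?_⟩
  rw [← S.ex_view_move (gates A x) x _ (hP x), ← ofReal_prob]
  exact ENNReal.ofReal_le_ofReal (hN x hx hxL)

theorem inverts_of_distInverts {i : Fin k} {F : FunFamily {j : Fin k // i < j}}
    (hF : F.inLen = S.domLen) (hFi : ∀ O x u, F.fn O x u = S.image x i u) {x : List Bool} {δ : ℝ}
    (h : DistInverts (A i) F (fun j => (A j.1).gate x.length) x δ) :
    S.Inverts (gates A x) x i (ENNReal.ofReal δ) := by
  intro Φ hΦ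
  rw [DistInverts, hF] at h
  simp only [hFi] at h
  have h1 := ENNReal.ofReal_le_ofReal h
  set X := (unif (S.domLen.eval (x.length + totalCoins fun j : {j : Fin k // i < j} =>
    (A j.1).gate x.length))).map fun u => (u, S.image x i u) with hX
  set Y := (unif (S.domLen.eval (x.length + totalCoins fun j : {j : Fin k // i < j} =>
    (A j.1).gate x.length))).bind fun u => ((A i).sample noOracle x.length
      (.cons (.ofBits x) (.ofBits (S.image x i u)))).map fun d => (d.toBits, S.image x i u) with hY
  have e1 : ex X (fun a => Φ a.1 a.2) = ex (unif (S.seedLen (gates A x) x i)) fun u =>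
      Φ u (S.image x i u) := by
    rw [hX, ex_map]; rfl
  have e2 : ex Y (fun a => Φ a.1 a.2) = ex (unif (S.seedLen (gates A x) x i)) fun u =>
      ex (unif (gates A x i).coins) fun α => Φ ((gates A x i).answer
        (.cons (.ofBits x) (.ofBits (S.image x i u))) α) (S.image x i u) := by
    rw [hY, ex_bind]
    simp only [RandAlg.sample, ex_map]
    rfl
  have hsymm : statDist Y X = statDist X Y := by simp only [statDist, abs_sub_comm]
  rw [← e1, ← e2]
  constructor
  · exact (ex_le_add_statDist X Y fun a => hΦ _ _).trans (add_le_add_right h1 _)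
  · exact (ex_le_add_statDist Y X fun a => hΦ _ _).trans (add_le_add_right (hsymm ▸ h1) _)

theorem ex_sim (G : Fin k → Gate) (x : List Bool) (i : Fin k) (f : List (List Bool) → ℝ≥0∞) :
    ex ((S.Sim.sample noOracle x.length (.ofBits x)).map Data.toMsgs) f =
      ex (unif (S.seedLen G x i)) fun u => f (S.simMsgs x u) := by
  have h : S.Sim.coins.eval x.length ≤ S.seedLen G x i := by
    simp only [seedLen, domLen, Polynomial.eval_add]
    exact (eval_mono _ (Nat.le_add_right _ _)).trans (Nat.le_add_right _ _)
  simp only [simMsgs]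
  rw [ex_unif_take h fun u => f (S.Sim.run noOracle (.ofBits x) u).toMsgs, ex_map, RandAlg.sample,
    ex_map, RandAlg.numCoins, totalCoins_noOracle, add_zero]

end Scheme

end CRZK

/-! ### Adding up the losses -/

namespace CRZK
open scoped ENNReal

/-- A polynomial with natural coefficients that dominates a given one and is positive. -/
theorem exists_natPoly_ge (p : Polynomial ℝ) :
    ∃ P : Polynomial ℕ, ∀ n : ℕ, p.eval (n : ℝ) ≤ (P.eval n : ℕ) ∧ 0 < P.eval n := by
  suffices h : ∃ P : Polynomial ℕ, ∀ n : ℕ, p.eval (n : ℝ) ≤ (P.eval n : ℕ) by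
    obtain ⟨P, hP⟩ := h
    refine ⟨P + 1, fun n => ?_⟩
    have := hP n
    simp only [Polynomial.eval_add, Polynomial.eval_one]
    push_cast
    exact ⟨by linarith, by omega⟩
  induction p using Polynomial.induction_on' with
  | add p q hp hq =>
    obtain ⟨P, hP⟩ := hp
    obtain ⟨Q, hQ⟩ := hq
    refine ⟨P + Q, fun n => ?_⟩
    simp only [Polynomial.eval_add, Nat.cast_add]
    exact add_le_add (hP n) (hQ n)
  | monomial j c =>
    refine ⟨.monomial j ⌈c⌉₊, fun n => ?_⟩
    simp only [Polynomial.eval_monomial, Nat.cast_mul, Nat.cast_pow]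
    gcongr
    exact Nat.le_ceil c

namespace Scheme

variable {k : ℕ} (S : Scheme k) (G : Fin k → Gate) (x : List Bool)

/-- With no rounds left the verdict does not depend on coins, so sampling never overestimates. -/
theorem count_excess_zero (t : List (List Bool)) :
    (ex (unif (S.samples.eval x.length * S.playCoins G x 0)) fun ω =>
      (S.count G x (S.play G x 0) 0 ω t : ℝ≥0∞) / (S.samples.eval x.length : ℕ) -
        S.val G x 0 t) ≤ 0 := by
  refine ex_le_const fun ω => ?_
  rw [nonpos_iff_eq_zero, tsub_eq_zero_iff_le, val_zero]
  cases h : S.V.accepts x t with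
  | true => exact ENNReal.div_le_of_le_mul (by rw [ind_true, one_mul]; exact_mod_cast S.count_le ..)
  | false => simp [count, play, h]

/-- Lower bound for the success probability of the inverting prover. -/
theorem le_val {P : Polynomial ℕ} (htries : S.tries = P) (hsamples : S.samples = ((P + 1) * P) ^ 2)
    (hP : 0 < P.eval x.length) (hW : S.Wide) {γ : Type} (X : PMF γ) (Q : γ → Strategy)
    {ε δ : ℝ} (hε0 : 0 ≤ ε) (hδ : 1 / ((P.eval x.length : ℕ) : ℝ) ≤ δ)
    (hI : ∀ i, S.Inverts G x i (ENNReal.ofReal δ))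
    (hε : ∀ d, d < k → ∀ θ < S.samples.eval x.length, ∀ α ω : List Bool,
      α.length = S.tries.eval x.length * (G (S.round d)).coins →
      ω.length = S.samples.eval x.length * S.playCoins G x d →
      (ex (X.bind fun g => S.V.view x (Q g)) fun t => ind (S.test G x d θ α ω t)) ≤
        (ex ((S.Sim.sample noOracle x.length (.ofBits x)).map Data.toMsgs) fun t =>
          ind (S.test G x d θ α ω t)) + ENNReal.ofReal ε) :
    (ex (X.bind fun g => S.V.view x (Q g)) fun t => ind (S.V.accepts x t)) ≤
      S.val G x k [] + ENNReal.ofReal (k * ε + (3 * k - 2) * δ) := by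
  set n := P.eval x.length with hn
  have hn' : (0 : ℝ) < n := by exact_mod_cast hP
  have hδ0 : 0 ≤ δ := le_trans (by positivity) hδ
  have hs : S.samples.eval x.length = ((n + 1) * n) ^ 2 := by simp [hsamples, hn]
  have hs0 : S.samples.eval x.length ≠ 0 := by rw [hs]; positivity
  have ht : S.tries.eval x.length = n := by rw [htries]
  -- The hybrids: the honest prover plays the first `k - d` rounds, the inverting prover the rest.
  let H : ℕ → ℝ≥0∞ := fun d => ex X fun g =>
    ex (transcript (fun i => S.V.coinLen i x.length) (Q g) (k - d)) (S.val G x d)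
  have hsim (d : ℕ) {c : ℝ≥0∞} (h : ∀ ω, (ex (unif (S.seedLen G x (S.round d))) fun u =>
      S.loseProb G x d ω ((S.simMsgs x u).takeD (2 * (S.round d : ℕ) + 1) [])
        (S.count G x (S.play G x d) d ω ((S.simMsgs x u).takeD (2 * (S.round d : ℕ) + 2) [])) ^
          S.tries.eval x.length) ≤ c) (ω : List Bool) :
      (ex ((S.Sim.sample noOracle x.length (.ofBits x)).map Data.toMsgs) fun t =>
        ex (unif (S.tries.eval x.length * (G (S.round d)).coins)) fun α =>
          (S.gap G x d α ω t : ℝ≥0∞) / (S.samples.eval x.length : ℕ)) ≤ c := by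
    rw [S.ex_sim G x (S.round d)]
    exact (ex_mono fun u => S.ex_gap_le G x d ω _).trans (h ω)
  -- Last round: no sampling error and no ranking loss.
  have h0 : H 0 ≤ H 1 + ENNReal.ofReal (ε + δ) := by
    refine (S.hybrid_step G x X Q _ S.pos hs0 (S.count_excess_zero G x) (hε 0 S.pos)
      (hsim 0 (S.ex_loseProb_last_le G x hW (hI _) (by omega)))).trans_eq ?_
    rw [mul_zero, zero_add (_ + _), add_comm ε, ENNReal.ofReal_add hδ0 hε0]
  -- The three `δ` come from the overestimation `(n+1)/(2(n+1)n)`, the ranking loss `1/(n+1)` and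
  -- the deviation of the inverter, where `n` is the number of attempts.
  have hsucc (d : ℕ) (hd : d + 1 < k) :
      H (d + 1) ≤ H (d + 2) + ENNReal.ofReal (ε + 3 * δ) := by
    have hB (t : List (List Bool)) :
        (ex (unif (S.samples.eval x.length * S.playCoins G x (d + 1))) fun ω =>
          (S.count G x (S.play G x (d + 1)) (d + 1) ω t : ℝ≥0∞) / (S.samples.eval x.length : ℕ) -
            S.val G x (d + 1) t) ≤ ENNReal.ofReal (1 / (2 * ((n + 1) * n : ℕ))) := by
      have h1 := ex_countP_excess (S.playCoins G x (d + 1)) ((n + 1) * n) (by positivity)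
        (S.play G x (d + 1) t)
      rw [← hs] at h1
      exact h1
    refine (S.hybrid_step G x X Q _ hd hs0 hB (hε _ hd) (hsim _
      (S.ex_loseProb_le G x hW (by simp only [round]; omega) (hI _)))).trans ?_
    gcongr H (d + 2) + ?_
    rw [ht, ← ENNReal.ofReal_natCast, ← ENNReal.ofReal_mul (by positivity),
      ← ENNReal.ofReal_inv_of_pos (by positivity),
      ← ENNReal.ofReal_add (by positivity) hδ0, ← ENNReal.ofReal_add (by positivity) hε0,
      ← ENNReal.ofReal_add (by positivity) (by positivity)]
    apply ENNReal.ofReal_le_ofReal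
    have e1 : ((n + 1 : ℕ) : ℝ) * (1 / (2 * ((n + 1) * n : ℕ))) ≤ δ := by
      refine le_trans ?_ hδ
      push_cast
      rw [mul_one_div, div_le_div_iff₀ (by positivity) hn']
      nlinarith
    have e2 : ((n + 1 : ℕ) : ℝ)⁻¹ ≤ δ := by
      refine le_trans ?_ hδ
      rw [one_div]
      gcongr
      simp
    linarith
  -- At `j = k - 1` the coefficients become `k` and `3k - 2`.
  have hall (j : ℕ) (hj : j < k) :
      H 0 ≤ H (j + 1) + ENNReal.ofReal ((j + 1) * ε + (3 * j + 1) * δ) := by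
    induction j with
    | zero => simpa using h0
    | succ j ih =>
      refine (ih (by omega)).trans ((add_le_add_left (hsucc j hj) _).trans_eq ?_)
      rw [add_assoc, ← ENNReal.ofReal_add (by positivity) (by positivity)]
      congr 2
      push_cast
      ring
  have hk := S.pos
  have hlast := hall (k - 1) (by omega)
  have e0 : H 0 = ex (X.bind fun g => S.V.view x (Q g)) fun t => ind (S.V.accepts x t) := by
    simp only [H, ex_bind, Nat.sub_zero, Verifier.view]
    congr 1; funext g; congr 1; funext t
    rw [val_zero]
  have ek : H (k - 1 + 1) = S.val G x k [] := by
    simp only [H, Nat.sub_add_cancel hk, Nat.sub_self, transcript, ex_pure, ex_const]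
  rw [e0, ek] at hlast
  refine hlast.trans_eq ?_
  rw [Nat.cast_sub hk]
  congr 2
  push_cast
  ring

end Scheme

/-- The reduction for protocols whose honest view is a mixture of views of prover strategies. -/
theorem exists_reduction_of_zeroKnowledge (k : ℕ) (hk : 1 ≤ k) (εc εs εz : ℕ → ℝ)
    (hεs : ∀ n, εs n ∈ Set.Icc (0 : ℝ) 1) (hεz : ∀ n, εz n ∈ Set.Icc (0 : ℝ) 1)
    (L : Language Bool) (rel : List Bool → List Bool → Prop) (hL : IsNPRelation L rel)
    (V : Verifier k) (view : List Bool → List Bool → PMF (List (List Bool)))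
    (hview : ∀ x w, ∃ (γ : Type) (X : PMF γ) (Q : γ → Strategy),
      view x w = X.bind fun g => V.view x (Q g))
    (hc : Complete V rel view εc) (hs : StatSound V L εs ∨ CompSound V L εs)
    (hz : ZeroKnowledge rel view εz)
    (p : Polynomial ℝ) (hp : ∀ᶠ n : ℕ in Filter.atTop, 0 < p.eval (n : ℝ)) :
    ∃ (R : RandAlg (Fin k)) (F : (i : Fin k) → FunFamily {j : Fin k // i < j}),
      ∀ A : Fin k → PPT, ∀ᶠ n : ℕ in Filter.atTop, ∀ x : List Bool, x.length = n →
        (x ∈ L →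
          (∀ i : Fin k,
            DistInverts (A i) (F i) (fun j => (A j.1).gate n) x (1 / p.eval (n : ℝ))) →
          1 - εc n - (k : ℝ) * εz n - (3 * (k : ℝ) - 2) / p.eval (n : ℝ) ≤
            prob (R.sample (fun j => (A j).gate n) n (.ofBits x)) Data.truthy) ∧
        (x ∉ L →
          prob (R.sample (fun j => (A j).gate n) n (.ofBits x)) Data.truthy ≤ εs n) := by
  obtain ⟨P, hP⟩ := exists_natPoly_ge p
  obtain ⟨Sim, hSim⟩ := hz.exists_sim
  obtain ⟨W, hW⟩ := Scheme.exists_wide ⟨V, Sim, P, ((P + 1) * P) ^ 2, 0, hk⟩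
  let S : Scheme k := ⟨V, Sim, P, ((P + 1) * P) ^ 2, W, hk⟩
  obtain ⟨R, hR⟩ := S.exists_reduction
  choose F hF hFi using fun i : Fin k => S.exists_family (ι := {j : Fin k // i < j}) i
  refine ⟨R, F, fun A => ?_⟩
  choose D b hD using S.exists_test A
  choose N hN using fun d => hSim (D d) (b d)
  have hsound : ∃ N, ∀ x : List Bool, N ≤ x.length → x ∉ L →
      S.val (Scheme.gates A x) x k [] ≤ ENNReal.ofReal (εs x.length) := by
    rcases hs with hs | hs
    · exact ⟨0, fun x _ hx => S.sound_of_statSound hs x hx _⟩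
    · exact S.sound_of_compSound A hs
  obtain ⟨N', hN'⟩ := hsound
  filter_upwards [hp, Filter.eventually_ge_atTop N',
    Filter.eventually_ge_atTop (∑ d ∈ Finset.range k, N d)] with n hpn hn' hn x hx
  subst hx
  have hprob : prob (R.sample (fun j => (A j).gate x.length) x.length (.ofBits x)) Data.truthy =
      (S.val (Scheme.gates A x) x k []).toReal := by
    have h := congrArg ENNReal.toReal (hR (Scheme.gates A x) x)
    rwa [ENNReal.toReal_ofReal (prob_nonneg _ _)] at h
  rw [hprob]
  constructor
  · intro hxL hinv
    obtain ⟨w, hw⟩ := (hL.2.2 x).1 hxL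
    obtain ⟨γ, X, Q, hv⟩ := hview x w
    have h1 := S.le_val (Scheme.gates A x) x (P := P) rfl rfl (hP _).2 hW X Q (hεz x.length).1
      (one_div_le_one_div_of_le hpn (hP x.length).1)
      (fun i => S.inverts_of_distInverts A (hF i) (hFi i) (hinv i)) fun d hd θ hθ α ω hα hω => by
        obtain ⟨z, hz, hDz⟩ := hD d x θ α ω hθ hα hω
        have h2 := hN d x w z (le_trans (Finset.single_le_sum (f := N) (fun _ _ => Nat.zero_le _)
          (Finset.mem_range.2 hd)) hn) hw hz
        refine le_trans ?_ (add_le_add_left (hDz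
          ((Sim.sample noOracle x.length (.ofBits x)).map Data.toMsgs)).le _)
        rw [← hDz, ← hv, ← ENNReal.ofReal_add
          (show 0 ≤ distProb _ x z _ from prob_nonneg _ _) (hεz _).1]
        apply ENNReal.ofReal_le_ofReal
        linarith [neg_abs_le (distProb (D d) x z
          ((Sim.sample noOracle x.length (.ofBits x)).map Data.toMsgs) -
            distProb (D d) x z (view x w))]
    have hk' : (1 : ℝ) ≤ k := by exact_mod_cast hk
    have hval : S.val (Scheme.gates A x) x k [] ≠ ⊤ :=
      ((S.val_le_one _ _ _ _).trans_lt ENNReal.one_lt_top).ne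
    have hloss : 0 ≤ (k : ℝ) * εz x.length +
        (3 * k - 2) * (1 / p.eval (x.length : ℝ)) :=
      add_nonneg (mul_nonneg (by linarith) (hεz _).1) (mul_nonneg (by linarith) (by positivity))
    rw [← hv, ← ofReal_prob, ← ENNReal.ofReal_toReal hval,
      ← ENNReal.ofReal_add ENNReal.toReal_nonneg hloss,
      ENNReal.ofReal_le_ofReal_iff (add_nonneg ENNReal.toReal_nonneg hloss)] at h1
    have h2 := hc x w hw
    change _ ≤ prob (view x w) (S.V.accepts x) at h2
    rw [mul_one_div] at h1
    linarith
  · intro hxL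
    exact ENNReal.toReal_le_of_le_ofReal (hεs _).1 (hN' x hn' hxL)

end CRZK

open CRZK

theorem lemma3p3 (k : ℕ) (hk : 1 ≤ k) (εc εs εz : ℕ → ℝ)
    (hεc : ∀ n, εc n ∈ Set.Icc (0 : ℝ) 1) (hεs : ∀ n, εs n ∈ Set.Icc (0 : ℝ) 1)
    (hεz : ∀ n, εz n ∈ Set.Icc (0 : ℝ) 1)
    (L : Language Bool) (rel : List Bool → List Bool → Prop) (hL : IsNPRelation L rel)
    (hZK : HasZKProof k L rel εc εs εz ∨ HasZKArgument k L rel εc εs εz)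
    (p : Polynomial ℝ) (hp : ∀ᶠ n : ℕ in Filter.atTop, 0 < p.eval (n : ℝ)) :
    ∃ (R : RandAlg (Fin k)) (F : (i : Fin k) → FunFamily {j : Fin k // i < j}),
      ∀ A : Fin k → PPT,
        ∃ ν : ℕ → ℝ, Asymptotics.SuperpolynomialDecay Filter.atTop (fun n : ℕ => (n : ℝ)) ν ∧
          ∀ᶠ n : ℕ in Filter.atTop, ∀ x : List Bool, x.length = n →
            (x ∈ L →
              (∀ i : Fin k,
                DistInverts (A i) (F i) (fun j => (A j.1).gate n) x (1 / p.eval (n : ℝ))) →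
              1 - εc n - (k : ℝ) * εz n - (3 * (k : ℝ) - 2) / p.eval (n : ℝ) - ν n ≤
                prob (R.sample (fun j => (A j).gate n) n (.ofBits x)) Data.truthy) ∧
            (x ∉ L →
              prob (R.sample (fun j => (A j).gate n) n (.ofBits x)) Data.truthy ≤ εs n) := by
  obtain ⟨R, F, h⟩ : ∃ (R : RandAlg (Fin k)) (F : (i : Fin k) → FunFamily {j : Fin k // i < j}),
      ∀ A : Fin k → PPT, ∀ᶠ n : ℕ in Filter.atTop, ∀ x : List Bool, x.length = n →
        (x ∈ L →
          (∀ i : Fin k,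
            DistInverts (A i) (F i) (fun j => (A j.1).gate n) x (1 / p.eval (n : ℝ))) →
          1 - εc n - (k : ℝ) * εz n - (3 * (k : ℝ) - 2) / p.eval (n : ℝ) ≤
            prob (R.sample (fun j => (A j).gate n) n (.ofBits x)) Data.truthy) ∧
        (x ∉ L →
          prob (R.sample (fun j => (A j).gate n) n (.ofBits x)) Data.truthy ≤ εs n) := by
    rcases hZK with ⟨V, P, hc, hs, hz⟩ | ⟨V, P, hc, hs, hz⟩
    · exact exists_reduction_of_zeroKnowledge k hk εc εs εz hεs hεz L rel hL V _
        (fun x w => ⟨Unit, PMF.pure (), fun _ => P x w, by rw [PMF.pure_bind]⟩) hc (.inl hs) hz p hp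
    · exact exists_reduction_of_zeroKnowledge k hk εc εs εz hεs hεz L rel hL V _
        -- An honest prover with one private random string for all rounds is not a single
        -- `Strategy`, but it is a mixture of strategies over that string.
        (fun x w => ⟨_, _, _, rfl⟩) hc (.inr hs) hz p hp
  -- The bound holds without slack, so `ν = 0` serves.
  exact ⟨R, F, fun A => ⟨fun _ => 0, Asymptotics.superpolynomialDecay_zero _ _, by
    simpa only [sub_zero] using h A⟩⟩
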